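/- **Notation.** $\ell^2_+(\mathbb C^k)$ is the Hilbert space of square summable unilateral sequences in $\mathbb C^k$. $\mathfrak{R}H^\infty_{k\times l}$ is the set of $k\times l$ rational matrix functions without poles in the closed unit disc. For a rational matrix function $\Omega$ put $\Omega^*(z)=\Omega(\bar z^{-1})^*$; if $\Omega$ has no poles on the unit circle $\mathbb T$, then $T_\Omega=(\Omega_{i-j})_{i,j\ge 0}:\ell^2_+(\mathbb C^l)\to\ell^2_+(\mathbb C^k)$ is the block Toeplitz operator built from the Fourier coefficients $\Omega_s$ of $\Omega|_{\mathbb T}$. A square matrix is stable if all its eigenvalues lie in the open unit disc. For a stable $n\times n$ matrix $A$, a matrix $C$ with $n$ columns and a matrix $B$ with $n$ rows, $W_{obs}x=(CA^\nu x)_{\nu\ge0}$ is the observability operator of $\{C,A\}$, $\sum_{\nu\ge0}(A^*)^\nu C^*CA^\nu$ is the observability Gramian of $\{C,A\}$ and $\sum_{\nu\ge0}A^\nu BB^*(A^*)^\nu$ is the controllability Gramian of $\{A,B\}$; $\{C,A\}$ is observable if $\operatorname{Ker}W_{obs}=\{0\}$. $E_{\mathcal X}$ denotes the embedding of a subspace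 $\mathcal X$, so $E_{\mathcal X}^*$ is the orthogonal projection onto $\mathcal X$. **Setting.** Let $A$ be a stable $n\times n$ matrix, let $C,\Gamma,R_0$ be matrices of sizes $m\times n$, $n\times m$, $m\times m$, and let $$R(z)=zC(I_n-zA)^{-1}\Gamma+R_0+\Gamma^*(zI_n-A^*)^{-1}C^*$$ satisfy $R(\zeta)\ge0$ for all $\zeta\in\mathbb T$. Let $\Phi\in\mathfrak{R}H^\infty_{r\times m}$ be an outer spectral factor of $R$, i.e. $R=\Phi^*\Phi$ and $T_\Phi$ has dense range. With $W_{obs}$ the observability operator of $\{C,A\}$, put $$\mathcal X_\Phi=\{x\in\mathbb C^n: W_{obs}x\in\operatorname{Im}T_\Phi^*\},\qquad \mathcal M_\Phi=\{f\in\ell^2_+(\mathbb C^r): T_\Phi^*f\in\operatorname{Im}W_{obs}\},$$ and let $\Theta\in\mathfrak{R}H^\infty_{r\times r}$ be the two-sided inner function (unitary values on $\mathbb T$) determined by $\mathcal M_\Phi$, i.e. $\operatorname{Ker}T_\Theta^*=\mathcal M_\Phi$. **Proposition 2.7.** Assume $\{C,A\}$ is observable. Then $F=\Phi^*\Theta$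 belongs to $\mathfrak{R}H^\infty_{m\times r}$. There is an $r\times n$ matrix $C_\Phi$ such that $$W_{obs}x=T_\Phi^*W_{\Phi,obs}x\quad(x\in\mathcal X_\Phi),\qquad W_{\Phi,obs}\text{ the observability operator of }\{C_\Phi,A\}.$$ For each such $C_\Phi$, with $Q_\Phi$ the observability Gramian of $\{C_\Phi,A\}$, there are matrices $B_\Theta$ ($n\times r$) and $D_\Theta$ ($r\times r$) with $$\Theta(z)=D_\Theta+zC_\Phi(I_n-zA)^{-1}B_\Theta,\qquad \operatorname{Im}B_\Theta\subset\mathcal X_\Phi,$$ and for all such $B_\Theta$, $D_\Theta$ the function $F$ admits the realization $$F(z)=\Phi(0)^*D_\Theta+\Gamma^*Q_\Phi B_\Theta+zC(I_n-zA)^{-1}B_\Theta .$$ Moreover, the map $E_{\mathcal X_\Phi}^*Q_\Phi E_{\mathcal X_\Phi}$ on $\mathcal X_\Phi$ is invertible, $\Delta=E_{\mathcal X_\Phi}(E_{\mathcal X_\Phi}^*Q_\Phi E_{\mathcal X_\Phi})^{-1}E_{\mathcal X_\Phi}^*$ is equal to the controllability Gramian of $\{A,B_\Theta\}$, and $$T_R=T_FT_F^*+W_{obs}\,\Delta\,W_{obs}^*.$$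 -/

import Mathlib

open scoped Matrix ENNReal InnerProductSpace ComplexOrder

noncomputable section

/-! ### Rational matrix functions -/

/-- A `k × l` rational matrix function: a matrix with entries in the field `ℂ(z)`. -/
abbrev RatMat (k l : ℕ) : Type := Matrix (Fin k) (Fin l) (RatFunc ℂ)

/-- A constant matrix, seen as a rational matrix function. -/
def constMat {k l : ℕ} (M : Matrix (Fin k) (Fin l) ℂ) : RatMat k l :=
  M.map RatFunc.C

/-- The value `Ω(w)` of a rational matrix function at a complex number `w` which is not a pole. -/
def evalMat {k l : ℕ} (Ω : RatMat k l) (w : ℂ) : Matrix (Fin k) (Fin l) ℂ :=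
  Ω.map (RatFunc.eval (RingHom.id ℂ) w)

/-- The number `w` is a pole of `Ω` if it is a zero of the reduced denominator of an entry. -/
def IsPole {k l : ℕ} (Ω : RatMat k l) (w : ℂ) : Prop :=
  ∃ i j, (Ω i j).denom.eval w = 0

/-- `Ω ∈ ℜH^∞`: the rational matrix function `Ω` is stable, i.e. it has no pole in the
closed unit disc. -/
def IsStableRational {k l : ℕ} (Ω : RatMat k l) : Prop :=
  ∀ w : ℂ, ‖w‖ ≤ 1 → ¬ IsPole Ω w

/-- For a scalar rational function `f`, the rational function `z ↦ conj (f (1 / conj z))`: conjugate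
all coefficients and substitute `1/z` for `z`. -/
def paraConjFun (f : RatFunc ℂ) : RatFunc ℂ :=
  RatFunc.eval ((RatFunc.C : ℂ →+* RatFunc ℂ).comp (starRingEnd ℂ)) (RatFunc.X)⁻¹ f

/-- The rational matrix function `Ω^*`, that is `Ω^*(z) = Ω(1 / conj z)ᴴ`. -/
def paraConj {k l : ℕ} (Ω : RatMat k l) : RatMat l k :=
  Ωᵀ.map paraConjFun

/-- The rational matrix function `D + z C (I - z A)⁻¹ B`. (The determinant of `I - z A` is a nonzero
element of the field `ℂ(z)`, because it is `1` at `z = 0`.) -/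
def realization {k l n : ℕ} (D : Matrix (Fin k) (Fin l) ℂ) (C : Matrix (Fin k) (Fin n) ℂ)
    (A : Matrix (Fin n) (Fin n) ℂ) (B : Matrix (Fin n) (Fin l) ℂ) : RatMat k l :=
  constMat D +
    (RatFunc.X : RatFunc ℂ) •
      (constMat C * (1 - (RatFunc.X : RatFunc ℂ) • constMat A)⁻¹ * constMat B)

/-- The rational matrix function
`R(z) = z C (I - z A)⁻¹ Γ + R₀ + Γᴴ (z I - Aᴴ)⁻¹ Cᴴ`. -/
def spectralFunction {m n : ℕ} (A : Matrix (Fin n) (Fin n) ℂ) (C : Matrix (Fin m) (Fin n) ℂ)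
    (Γ : Matrix (Fin n) (Fin m) ℂ) (R₀ : Matrix (Fin m) (Fin m) ℂ) : RatMat m m :=
  (RatFunc.X : RatFunc ℂ) •
      (constMat C * (1 - (RatFunc.X : RatFunc ℂ) • constMat A)⁻¹ * constMat Γ)
    + constMat R₀
    + constMat Γᴴ * ((RatFunc.X : RatFunc ℂ) • (1 : RatMat n n) - constMat Aᴴ)⁻¹ * constMat Cᴴ

/-! ### The spaces `ℓ²₊(ℂᵏ)` and block Toeplitz operators -/

/-- `ℓ²₊(ℂᵏ)`, the Hilbert space of square summable unilateral sequences in `ℂᵏ`. -/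
abbrev L2plus (k : ℕ) : Type := lp (fun _ : ℕ => EuclideanSpace ℂ (Fin k)) 2

/-- The `s`-th block Fourier coefficient `Ω_s` of the restriction of `Ω` to the unit circle. -/
def fourierBlock {k l : ℕ} (Ω : RatMat k l) (s : ℤ) : Matrix (Fin k) (Fin l) ℂ :=
  Matrix.of fun a b => fourierCoeff (fun t : UnitAddCircle => evalMat Ω (t.toCircle : ℂ) a b) s

/-- The bounded operator `T` has the block Toeplitz matrix `(Ω_{i-j})_{i,j ≥ 0}`. -/
def HasToeplitzMatrix {k l : ℕ} (Ω : RatMat k l) (T : L2plus l →L[ℂ] L2plus k) : Prop :=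
  ∀ (i j : ℕ) (u : EuclideanSpace ℂ (Fin l)),
    T (lp.single 2 j u) i = Matrix.toEuclideanLin (fourierBlock Ω ((i : ℤ) - (j : ℤ))) u

/-- Multiplication by a continuous function, as a bounded operator on `L²` of the circle. -/
theorem exists_mul_fourier (f : C(UnitAddCircle, ℂ)) :
    ∃ M : MeasureTheory.Lp ℂ 2 (AddCircle.haarAddCircle (T := (1 : ℝ))) →L[ℂ]
        MeasureTheory.Lp ℂ 2 (AddCircle.haarAddCircle (T := (1 : ℝ))),
      ∀ i j : ℤ, ⟪fourierLp (T := (1 : ℝ)) 2 i, M (fourierLp 2 j)⟫_ℂ = fourierCoeff f (i - j) := by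
  refine ⟨(ContinuousLinearMap.mul ℂ ℂ).holderL AddCircle.haarAddCircle ∞ 2 2
    (ContinuousMap.toLp ∞ AddCircle.haarAddCircle ℂ f), fun i j => ?_⟩
  rw [MeasureTheory.L2.inner_def, fourierCoeff]
  refine MeasureTheory.integral_congr_ae ?_
  filter_upwards [(ContinuousLinearMap.mul ℂ ℂ).coeFn_holder (r := 2)
      (ContinuousMap.toLp ∞ AddCircle.haarAddCircle ℂ f) (fourierLp (T := (1 : ℝ)) 2 j),
    coeFn_fourierLp (T := (1 : ℝ)) 2 i, coeFn_fourierLp (T := (1 : ℝ)) 2 j,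
    ContinuousMap.coeFn_toLp (p := ∞) (𝕜 := ℂ) AddCircle.haarAddCircle f] with t h1 h2 h3 h4
  rw [ContinuousLinearMap.holderL_apply_apply, h1, h2, h3, h4]
  have : -(i - j) = -i + j := by ring
  rw [this, fourier_add, fourier_neg]
  simp [RCLike.inner_apply]
  ring

/-- The `a`-th coordinate of a sequence of vectors, as an operator `ℓ²₊(ℂᵏ) → ℓ²₊`. -/
def coordCLM (k : ℕ) (a : Fin k) : L2plus k →L[ℂ] lp (fun _ : ℕ => ℂ) 2 :=
  LinearMap.mkContinuous
    { toFun := fun x => ⟨fun i => x i a, by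
        refine (memℓp_gen_iff (by norm_num)).2 ?_
        have h := (memℓp_gen_iff (by norm_num)).1 x.2
        refine h.of_nonneg_of_le (fun i => by positivity) fun i => ?_
        gcongr
        exact PiLp.norm_apply_le (x i) a⟩
      map_add' := fun x y => by ext i; rfl
      map_smul' := fun c x => by ext i; simp }
    1 (fun x => by
      rw [one_mul]
      refine lp.norm_le_of_tsum_le (by norm_num) (norm_nonneg _) ?_
      rw [lp.norm_rpow_eq_tsum (by norm_num)]
      have h := (memℓp_gen_iff (by norm_num)).1 x.2
      have hle : ∀ i, ‖x i a‖ ^ (2 : ℝ≥0∞).toReal ≤ ‖x i‖ ^ (2 : ℝ≥0∞).toReal := fun i => by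
        gcongr
        exact PiLp.norm_apply_le (x i) a
      exact (h.of_nonneg_of_le (fun i => by positivity) hle).tsum_le_tsum hle h)

theorem coordCLM_single (k : ℕ) (a : Fin k) (j : ℕ) (u : EuclideanSpace ℂ (Fin k)) :
    coordCLM k a (lp.single 2 j u) = lp.single 2 j (u a) := by
  ext i
  change (lp.single 2 j u : L2plus k) i a = _
  by_cases h : i = j
  · subst h; simp
  · simp [lp.single_apply, h]

theorem exists_toeplitz {k l : ℕ} (f : Fin k → Fin l → C(UnitAddCircle, ℂ)) :
    ∃ T : L2plus l →L[ℂ] L2plus k, ∀ (i j : ℕ) (u : EuclideanSpace ℂ (Fin l)),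
      T (lp.single 2 j u) i =
        Matrix.toEuclideanLin (Matrix.of fun a b => fourierCoeff (f a b) ((i : ℤ) - (j : ℤ))) u := by
  choose M hM using fun a b => exists_mul_fourier (f a b)
  have hon : Orthonormal ℂ (fun i : ℕ => fourierLp (T := (1 : ℝ)) 2 (i : ℤ)) :=
    orthonormal_fourier.comp _ Nat.cast_injective
  let J := hon.orthogonalFamily.linearIsometry
  have hJ : ∀ (i : ℕ) (c : ℂ), J (lp.single 2 i c) = c • fourierLp (T := (1 : ℝ)) 2 (i : ℤ) :=
    fun i c => by
      change hon.orthogonalFamily.linearIsometry _ = _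
      rw [OrthogonalFamily.linearIsometry_apply_single]
      simp
  let Jc := J.toContinuousLinearMap
  refine ⟨∑ a, ∑ b, (ContinuousLinearMap.adjoint (Jc ∘L coordCLM k a)) ∘L
    (M a b) ∘L Jc ∘L coordCLM l b, fun i j u => ?_⟩
  refine ext_inner_left ℂ fun v => ?_
  refine (lp.inner_single_left (𝕜 := ℂ) (G := fun _ : ℕ => EuclideanSpace ℂ (Fin k)) i v _).symm.trans ?_
  simp only [sum_apply, ContinuousLinearMap.comp_apply, inner_sum,
    ContinuousLinearMap.adjoint_inner_right, coordCLM_single]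
  have : ∀ (i : ℕ) (c : ℂ), Jc (lp.single 2 i c) = c • fourierLp (T := (1 : ℝ)) 2 (i : ℤ) := hJ
  simp only [this, map_smul, inner_smul_left, inner_smul_right, hM]
  simp only [PiLp.inner_apply, Matrix.toLpLin_apply, Matrix.mulVec, dotProduct,
    Matrix.of_apply, RCLike.inner_apply, Finset.sum_mul]
  refine Finset.sum_congr rfl fun a _ => Finset.sum_congr rfl fun b _ => by ring


theorem HasToeplitzMatrix.unique {k l : ℕ} {Ω : RatMat k l} {T T' : L2plus l →L[ℂ] L2plus k}
    (h : HasToeplitzMatrix Ω T) (h' : HasToeplitzMatrix Ω T') : T = T' := by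
  ext1 x
  have hx := lp.hasSum_single (E := fun _ : ℕ => EuclideanSpace ℂ (Fin l)) (p := 2) (by norm_num) x
  have h1 := hx.mapL T
  have h2 := hx.mapL T'
  have : ∀ j, T (lp.single 2 j (x j)) = T' (lp.single 2 j (x j)) := fun j => by
    ext1
    funext i
    rw [h i j, h' i j]
  simp only [this] at h1
  exact h1.unique h2

open Classical in
/-- The block Toeplitz operator `T_Ω : ℓ²₊(ℂˡ) → ℓ²₊(ℂᵏ)`: the bounded operator with the block
matrix `(Ω_{i-j})_{i,j ≥ 0}`. By `toeplitz_spec` it exists (and by `HasToeplitzMatrix.unique` it is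
unique) whenever `Ω` has no pole on the unit circle. -/
def toeplitz {k l : ℕ} (Ω : RatMat k l) : L2plus l →L[ℂ] L2plus k :=
  if h : ∃ T, HasToeplitzMatrix Ω T then h.choose else 0

theorem toeplitz_spec {k l : ℕ} (Ω : RatMat k l) (hΩ : ∀ w : ℂ, ‖w‖ = 1 → ¬ IsPole Ω w) :
    HasToeplitzMatrix Ω (toeplitz Ω) := by
  have hcont : ∀ a b, Continuous fun t : UnitAddCircle => evalMat Ω (t.toCircle : ℂ) a b := by
    intro a b
    have h1 : Continuous fun t : UnitAddCircle => (t.toCircle : ℂ) :=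
      continuous_subtype_val.comp AddCircle.continuous_toCircle
    have h2 : ∀ t : UnitAddCircle,
        Polynomial.eval₂ (RingHom.id ℂ) (t.toCircle : ℂ) (Ω a b).denom ≠ 0 := fun t h0 =>
      hΩ _ (Circle.norm_coe _) ⟨a, b, h0⟩
    have h3 : ∀ p : Polynomial ℂ,
        Continuous fun t : UnitAddCircle => Polynomial.eval₂ (RingHom.id ℂ) (t.toCircle : ℂ) p :=
      fun p => p.continuous.comp h1
    exact (h3 _).div (h3 _) h2
  have h : ∃ T, HasToeplitzMatrix Ω T := exists_toeplitz fun a b => ⟨_, hcont a b⟩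
  rw [toeplitz, dif_pos h]
  exact h.choose_spec

/-! ### Stable matrices, observability operators and Gramians -/

/-- The matrix `A` is stable: all its eigenvalues lie in the open unit disc. -/
def IsStableMat {n : ℕ} (A : Matrix (Fin n) (Fin n) ℂ) : Prop :=
  ∀ μ ∈ spectrum ℂ A, ‖μ‖ < 1

section
open scoped Matrix.Norms.L2Operator

theorem IsStableMat.summable_norm_pow {n : ℕ} {A : Matrix (Fin n) (Fin n) ℂ}
    (hA : IsStableMat A) : Summable fun ν : ℕ => ‖A ^ ν‖ := by
  rcases isEmpty_or_nonempty (Fin n) with h | h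
  · have : ∀ ν : ℕ, ‖A ^ ν‖ = 0 := fun ν => by rw [Subsingleton.elim (A ^ ν) 0, norm_zero]
    simpa only [this] using summable_zero
  have h1 : spectralRadius ℂ A < 1 := by
    have := spectrum.spectralRadius_lt_of_forall_lt A (r := 1) (fun μ hμ => by
      exact_mod_cast hA μ hμ)
    simpa using this
  obtain ⟨ρ, hρ1, hρ2⟩ := exists_between h1
  have h2 := spectrum.pow_nnnorm_pow_one_div_tendsto_nhds_spectralRadius A
  have h3 := h2.eventually (gt_mem_nhds hρ1)
  lift ρ to NNReal using (hρ2.trans ENNReal.one_lt_top).ne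
  have hρ : (ρ : ℝ) < 1 := by exact_mod_cast hρ2
  refine summable_of_isBigO_nat (summable_geometric_of_lt_one ρ.2 hρ) (Asymptotics.IsBigO.of_bound 1 ?_)
  filter_upwards [h3, Filter.eventually_gt_atTop 0] with ν hν hpos
  have hν' : ((‖A ^ ν‖₊ : ℝ≥0∞) ^ (1 / ν : ℝ)) ^ (ν : ℝ) ≤ (ρ : ℝ≥0∞) ^ (ν : ℝ) :=
    ENNReal.rpow_le_rpow hν.le (by positivity)
  rw [← ENNReal.rpow_mul, one_div, inv_mul_cancel₀ (by positivity), ENNReal.rpow_one,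
    ENNReal.rpow_natCast] at hν'
  have : ‖A ^ ν‖₊ ≤ ρ ^ ν := by exact_mod_cast hν'
  have h' : ‖A ^ ν‖ ≤ (ρ : ℝ) ^ ν := by exact_mod_cast this
  simpa using h'

theorem IsStableMat.memℓp_obs {k n : ℕ} {A : Matrix (Fin n) (Fin n) ℂ} (hA : IsStableMat A)
    (C : Matrix (Fin k) (Fin n) ℂ) (x : EuclideanSpace ℂ (Fin n)) :
    Memℓp (fun ν : ℕ => Matrix.toEuclideanLin (C * A ^ ν) x) 2 := by
  refine Memℓp.of_exponent_ge (q := 1) (memℓp_gen ?_) (by norm_num)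
  simp only [ENNReal.toReal_one, Real.rpow_one]
  refine ((hA.summable_norm_pow.mul_left ‖C‖).mul_right ‖x‖).of_nonneg_of_le
    (fun _ => norm_nonneg _) fun ν => ?_
  exact (Matrix.l2_opNorm_mulVec (C * A ^ ν) x).trans
    (mul_le_mul_of_nonneg_right (Matrix.l2_opNorm_mul C (A ^ ν)) (norm_nonneg x))

theorem IsStableMat.summable_contr {k n : ℕ} {A : Matrix (Fin n) (Fin n) ℂ}
    (hA : IsStableMat A) (B : Matrix (Fin n) (Fin k) ℂ) :
    Summable fun ν : ℕ => A ^ ν * B * Bᴴ * Aᴴ ^ ν := by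
  have hb : ∀ᶠ ν : ℕ in Filter.cofinite, ‖A ^ ν‖ ≤ 1 :=
    hA.summable_norm_pow.tendsto_cofinite_zero.eventually (ge_mem_nhds one_pos)
  refine Summable.of_norm_bounded_eventually (hA.summable_norm_pow.mul_right ‖B * Bᴴ‖) ?_
  filter_upwards [hb] with ν hν
  rw [← Matrix.conjTranspose_pow, Matrix.mul_assoc (A ^ ν)]
  calc _ ≤ ‖A ^ ν * (B * Bᴴ)‖ * ‖(A ^ ν)ᴴ‖ := norm_mul_le _ _
    _ ≤ (‖A ^ ν‖ * ‖B * Bᴴ‖) * 1 := by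
      rw [Matrix.l2_opNorm_conjTranspose]
      gcongr
      exact norm_mul_le _ _
    _ = _ := by ring

theorem IsStableMat.conjTranspose {n : ℕ} {A : Matrix (Fin n) (Fin n) ℂ}
    (hA : IsStableMat A) : IsStableMat Aᴴ := fun μ hμ => by
  rw [← Matrix.star_eq_conjTranspose, spectrum.map_star] at hμ
  simpa using hA _ (Set.mem_star.1 hμ)

theorem IsStableMat.summable_obs {k n : ℕ} {A : Matrix (Fin n) (Fin n) ℂ}
    (hA : IsStableMat A) (C : Matrix (Fin k) (Fin n) ℂ) :
    Summable fun ν : ℕ => Aᴴ ^ ν * Cᴴ * C * A ^ ν := by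
  simpa using hA.conjTranspose.summable_contr Cᴴ

end

/-- The observability operator `x ↦ (C x, C A x, C A² x, …)` of the pair `{C, A}`, from `ℂⁿ` to
`ℓ²₊(ℂᵏ)`, for a stable matrix `A`. -/
def obsOp {k n : ℕ} (C : Matrix (Fin k) (Fin n) ℂ) (A : Matrix (Fin n) (Fin n) ℂ)
    (hA : IsStableMat A) : EuclideanSpace ℂ (Fin n) →L[ℂ] L2plus k :=
  LinearMap.toContinuousLinearMap
    { toFun := fun x => ⟨fun ν : ℕ => Matrix.toEuclideanLin (C * A ^ ν) x, hA.memℓp_obs C x⟩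
      map_add' := fun x y => by
        ext1; funext ν; exact map_add (Matrix.toEuclideanLin (C * A ^ ν)) x y
      map_smul' := fun c x => by
        ext1; funext ν; exact map_smul (Matrix.toEuclideanLin (C * A ^ ν)) c x }

/-- The pair `{C, A}` is observable: the kernel of its observability operator is zero. -/
def IsObservable {k n : ℕ} (C : Matrix (Fin k) (Fin n) ℂ) (A : Matrix (Fin n) (Fin n) ℂ)
    (hA : IsStableMat A) : Prop :=
  LinearMap.ker (obsOp C A hA : EuclideanSpace ℂ (Fin n) →ₗ[ℂ] L2plus k) = ⊥

/-- The observability Gramian `∑ (Aᴴ)^ν Cᴴ C A^ν` of the pair `{C, A}`. The series converges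
if `A` is stable. -/
def obsGramian {k n : ℕ} (C : Matrix (Fin k) (Fin n) ℂ) (A : Matrix (Fin n) (Fin n) ℂ) :
    Matrix (Fin n) (Fin n) ℂ :=
  ∑' ν : ℕ, Aᴴ ^ ν * Cᴴ * C * A ^ ν

/-- The controllability Gramian `∑ A^ν B Bᴴ (Aᴴ)^ν` of the pair `{A, B}`. The series converges
if `A` is stable. -/
def contrGramian {k n : ℕ} (A : Matrix (Fin n) (Fin n) ℂ) (B : Matrix (Fin n) (Fin k) ℂ) :
    Matrix (Fin n) (Fin n) ℂ :=
  ∑' ν : ℕ, A ^ ν * B * Bᴴ * Aᴴ ^ ν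

/-! ### Outer spectral factor, the spaces `𝒳_Φ` and `ℳ_Φ`, and the inner function -/

/-- `Φ` is an outer spectral factor of `R`: it is stable rational, `R = Φ^* Φ`, and the range of
the Toeplitz operator `T_Φ` is dense. -/
structure IsOuterSpectralFactor {m r : ℕ} (R : RatMat m m) (Φ : RatMat r m) : Prop where
  stable : IsStableRational Φ
  factor : R = paraConj Φ * Φ
  outer : DenseRange (toeplitz Φ)

/-- `Θ` is two-sided inner and rational: it is stable rational and its values on the unit circle
are unitary matrices. -/
structure IsTwoSidedInner {r : ℕ} (Θ : RatMat r r) : Prop where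
  stable : IsStableRational Θ
  unitary : ∀ ζ : ℂ, ‖ζ‖ = 1 → evalMat Θ ζ ∈ Matrix.unitaryGroup (Fin r) ℂ

/-- The space `𝒳_Φ` of all `x ∈ ℂⁿ` with `W_obs x ∈ Im T_Φ^*`. -/
def spaceX {m n r : ℕ} (C : Matrix (Fin m) (Fin n) ℂ) (A : Matrix (Fin n) (Fin n) ℂ)
    (hA : IsStableMat A) (Φ : RatMat r m) : Submodule ℂ (EuclideanSpace ℂ (Fin n)) :=
  (LinearMap.range
    (ContinuousLinearMap.adjoint (toeplitz Φ) : L2plus r →ₗ[ℂ] L2plus m)).comap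
      (obsOp C A hA : EuclideanSpace ℂ (Fin n) →ₗ[ℂ] L2plus m)

/-- The space `ℳ_Φ` of all `f ∈ ℓ²₊(ℂʳ)` with `T_Φ^* f ∈ Im W_obs`. -/
def spaceM {m n r : ℕ} (C : Matrix (Fin m) (Fin n) ℂ) (A : Matrix (Fin n) (Fin n) ℂ)
    (hA : IsStableMat A) (Φ : RatMat r m) : Submodule ℂ (L2plus r) :=
  (LinearMap.range (obsOp C A hA : EuclideanSpace ℂ (Fin n) →ₗ[ℂ] L2plus m)).comap
    (ContinuousLinearMap.adjoint (toeplitz Φ) : L2plus r →ₗ[ℂ] L2plus m)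

/-- `Θ` is the two-sided inner function determined by `ℳ_Φ`, i.e. `Ker T_Θ^* = ℳ_Φ`. -/
structure IsInnerDeterminedBy {r : ℕ} (Θ : RatMat r r) (M : Submodule ℂ (L2plus r)) : Prop where
  inner : IsTwoSidedInner Θ
  ker_eq : LinearMap.ker
    (ContinuousLinearMap.adjoint (toeplitz Θ) : L2plus r →ₗ[ℂ] L2plus r) = M

/-- `C_Φ` satisfies the identity `W_obs x = T_Φ^* W_{Φ,obs} x` for `x ∈ 𝒳_Φ`, where `W_{Φ,obs}`
is the observability operator of the pair `{C_Φ, A}`. -/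
def IsStateOutput {m n r : ℕ} (C : Matrix (Fin m) (Fin n) ℂ) (A : Matrix (Fin n) (Fin n) ℂ)
    (hA : IsStableMat A) (Φ : RatMat r m) (CΦ : Matrix (Fin r) (Fin n) ℂ) : Prop :=
  ∀ x ∈ spaceX C A hA Φ,
    obsOp C A hA x = ContinuousLinearMap.adjoint (toeplitz Φ) (obsOp CΦ A hA x)

/-- `Θ(z) = D_Θ + z C_Φ (I - z A)⁻¹ B_Θ`, with a matrix `B_Θ` that maps `ℂʳ` into the subspace `X`
of the state space. -/
structure IsThetaRealization {n r : ℕ} (X : Submodule ℂ (EuclideanSpace ℂ (Fin n)))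
    (A : Matrix (Fin n) (Fin n) ℂ) (CΦ : Matrix (Fin r) (Fin n) ℂ) (Θ : RatMat r r)
    (BΘ : Matrix (Fin n) (Fin r) ℂ) (DΘ : Matrix (Fin r) (Fin r) ℂ) : Prop where
  range_le : LinearMap.range (Matrix.toEuclideanLin BΘ) ≤ X
  eq : Θ = realization DΘ CΦ A BΘ

/-- The compression `E_X^* Q E_X : X → X` of the matrix `Q` to the subspace `X`, where `E_X` is the
embedding of `X` and its adjoint `E_X^*` is the orthogonal projection onto `X`. -/
def compression {n : ℕ} (X : Submodule ℂ (EuclideanSpace ℂ (Fin n)))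
    (Q : Matrix (Fin n) (Fin n) ℂ) : X →L[ℂ] X :=
  X.orthogonalProjectionOnto ∘L Matrix.toEuclideanCLM (𝕜 := ℂ) Q ∘L X.subtypeL

/-- The map `E_X (E_X^* Q E_X)⁻¹ E_X^*` on `ℂⁿ` (used when the compression `E_X^* Q E_X`
is invertible). -/
def deltaMap {n : ℕ} (X : Submodule ℂ (EuclideanSpace ℂ (Fin n)))
    (Q : Matrix (Fin n) (Fin n) ℂ) :
    EuclideanSpace ℂ (Fin n) →L[ℂ] EuclideanSpace ℂ (Fin n) :=
  X.subtypeL ∘L Ring.inverse (compression X Q) ∘L X.orthogonalProjectionOnto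

end

/-!
Write `Z` for the backward shift, `W` and `V` for the observability operators of `{C, A}` and
`{C_Φ, A}`, and `L` for the restriction of `V` to `𝒳_Φ`. Three facts carry the proof.

* For stable `Ω`, `Ω₁`, `Ω₂` one has `Z T_Ω^* = T_Ω^* Z` and `T_{Ω₁^* Ω₂} = T_{Ω₁}^* T_{Ω₂}`
  (`IsStableRational.adjoint_toeplitz_bshift`, `toeplitz_paraConj_mul`, from Parseval's identity). In
  particular `T_R = T_Φ^* T_Φ`, `T_F = T_Φ^* T_Θ` and `T_Θ^* T_Θ = 1`. Moreover `Z V = V A`.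
* `T_Φ^*` is injective because `Φ` is outer, and `W` is injective by observability. As `T_Φ^* L` is the
  restriction of `W` to `𝒳_Φ`, the operator `L` is an injection of `𝒳_Φ` onto
  `ℳ_Φ = Ker T_Θ^*` (`mem_spaceM_iff`).
* A rational matrix function without poles on the circle is determined by its Fourier coefficients, and
  those of a realization are read off from the resolvent series
  (`eq_realization_of_bshift_toeplitz`).

The shifted columns `Z Θ u` and `Z Φ v` lie in `ℳ_Φ`, hence are of the form `L B_Θ u` and
`L Γ v` (`exists_isThetaRealization`, `bshift_outer_column`). The first gives the realization of `Θ`,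
and both together the Fourier coefficients of `F` (`paraConj_mul_eq_realization`); in particular those
of negative index vanish, which is the stability of `F`.

Since `L` is injective, `G = (L^* L)⁻¹` exists, `L^* L` being the compression of `Q_Φ`, and
`L G L^* = 1 - T_Θ T_Θ^*` is the projection onto `ℳ_Φ` (`isometry_adjoint_add_projection`). Inserting
it into `T_Φ^* T_Φ` gives the formula for `T_R`. Comparing this projection with its compression by
the shift shows that `Δ` solves the Stein equation `Δ = A Δ Aᴴ + B_Θ B_Θᴴ`
(`stein_of_shift_invariant`), whose only solution is the controllability Gramian
(`contrGramian_eq_of_stein`).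
-/

noncomputable section


/-! ### Evaluation of rational functions -/

/-- The local ring of the rational functions without a pole at `w`. -/
def regularRing (w : ℂ) : Subring (RatFunc ℂ) where
  carrier := {f | f.denom.eval w ≠ 0}
  mul_mem' {f g} hf hg := fun h => by
    obtain ⟨q, hq⟩ := RatFunc.denom_mul_dvd f g
    have := congrArg (Polynomial.eval w) hq
    rw [Polynomial.eval_mul, Polynomial.eval_mul, h, zero_mul] at this
    exact mul_ne_zero hf hg this
  add_mem' {f g} hf hg := fun h => by
    obtain ⟨q, hq⟩ := RatFunc.denom_add_dvd f g
    have := congrArg (Polynomial.eval w) hq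
    rw [Polynomial.eval_mul, Polynomial.eval_mul, h, zero_mul] at this
    exact mul_ne_zero hf hg this
  one_mem' := by simp
  zero_mem' := by simp
  neg_mem' {f} hf := fun h => by
    obtain ⟨q, hq⟩ := RatFunc.denom_mul_dvd (RatFunc.C (-1)) f
    have e : RatFunc.C (-1) * f = -f := by simp
    have := congrArg (Polynomial.eval w) hq
    rw [e, RatFunc.denom_C, one_mul, Polynomial.eval_mul, h, zero_mul] at this
    exact hf this

theorem mem_regularRing {w : ℂ} {f : RatFunc ℂ} : f ∈ regularRing w ↔ f.denom.eval w ≠ 0 :=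
  Iff.rfl

/-- Evaluation at `w`, as a ring homomorphism on the rational functions without a pole at `w`. -/
def evalAt (w : ℂ) : regularRing w →+* ℂ where
  toFun f := RatFunc.eval (RingHom.id ℂ) w f
  map_one' := RatFunc.eval_one _ _
  map_zero' := RatFunc.eval_zero _ _
  map_mul' f g := RatFunc.eval_mul _ _ f.2 g.2
  map_add' f g := RatFunc.eval_add _ _ f.2 g.2

theorem C_mem_regularRing (w c : ℂ) : RatFunc.C c ∈ regularRing w := by
  simp [mem_regularRing]

theorem X_mem_regularRing (w : ℂ) : RatFunc.X ∈ regularRing w := by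
  simp [mem_regularRing]

theorem inv_mem_regularRing {w : ℂ} {f : RatFunc ℂ} (hf : f ∈ regularRing w)
    (h0 : RatFunc.eval (RingHom.id ℂ) w f ≠ 0) :
    f⁻¹ ∈ regularRing w ∧
      RatFunc.eval (RingHom.id ℂ) w f⁻¹ = (RatFunc.eval (RingHom.id ℂ) w f)⁻¹ := by
  have hne : f ≠ 0 := by rintro rfl; simp at h0
  have hmem : f⁻¹ ∈ regularRing w := fun h => by
    obtain ⟨q, hq⟩ := RatFunc.denom_inv_dvd hne
    have h1 := congrArg (Polynomial.eval w) hq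
    rw [Polynomial.eval_mul, h, zero_mul] at h1
    apply h0
    change f.num.eval w / f.denom.eval w = 0
    rw [h1, zero_div]
  refine ⟨hmem, eq_inv_of_mul_eq_one_left ?_⟩
  have := (evalAt w).map_mul ⟨_, hmem⟩ ⟨_, hf⟩
  refine this.symm.trans ?_
  have h1 : (⟨_, hmem⟩ : regularRing w) * ⟨_, hf⟩ = 1 := Subtype.ext (inv_mul_cancel₀ hne)
  rw [h1, map_one]

/-- Two rational functions without poles on the unit circle that agree there are equal. -/
theorem RatFunc.eq_of_eval_circle_eq {f g : RatFunc ℂ}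
    (hf : ∀ w : ℂ, ‖w‖ = 1 → f ∈ regularRing w) (hg : ∀ w : ℂ, ‖w‖ = 1 → g ∈ regularRing w)
    (h : ∀ w : ℂ, ‖w‖ = 1 →
      RatFunc.eval (RingHom.id ℂ) w f = RatFunc.eval (RingHom.id ℂ) w g) : f = g := by
  have hinf : (Metric.sphere (0 : ℂ) 1).Infinite := by
    have : Infinite (Set.Ioc (-Real.pi) Real.pi) :=
      (Set.Ioc_infinite (by linarith [Real.pi_pos])).to_subtype
    have : Infinite Circle := Infinite.of_injective _ Circle.argEquiv.symm.injective
    refine (Set.infinite_range_of_injective (f := fun z : Circle => (z : ℂ))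
      Circle.coe_injective).mono ?_
    rintro _ ⟨z, rfl⟩
    simpa using Circle.norm_coe z
  have hp : f.num * g.denom = g.num * f.denom := by
    refine Polynomial.eq_of_infinite_eval_eq _ _ (hinf.mono fun w hw => ?_)
    have hw1 : ‖w‖ = 1 := by simpa using hw
    have h1 : f.num.eval w / f.denom.eval w = g.num.eval w / g.denom.eval w := h w hw1
    rw [div_eq_div_iff (hf w hw1) (hg w hw1)] at h1
    simpa using h1
  rw [← f.num_div_denom, ← g.num_div_denom, div_eq_div_iff
    (RatFunc.algebraMap_ne_zero f.denom_ne_zero) (RatFunc.algebraMap_ne_zero g.denom_ne_zero),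
    ← map_mul, ← map_mul, hp]

/-- On the unit circle `1 / w` is the conjugate of `w`. -/
theorem paraConjFun_eval {f : RatFunc ℂ} {w : ℂ} (hw : ‖w‖ = 1) (hf : f ∈ regularRing w) :
    paraConjFun f ∈ regularRing w ∧ RatFunc.eval (RingHom.id ℂ) w (paraConjFun f) =
      starRingEnd ℂ (RatFunc.eval (RingHom.id ℂ) w f) := by
  have hw0 : w ≠ 0 := by rintro rfl; simp at hw
  have hX := inv_mem_regularRing (X_mem_regularRing w) (by simpa using hw0)
  have hwi : w⁻¹ = starRingEnd ℂ w := (Complex.inv_eq_conj hw)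
  have key : ∀ p : Polynomial ℂ, ∃ h : p.eval₂ ((RatFunc.C : ℂ →+* RatFunc ℂ).comp (starRingEnd ℂ))
      (RatFunc.X)⁻¹ ∈ regularRing w, evalAt w ⟨_, h⟩ = starRingEnd ℂ (p.eval w) := by
    intro p
    induction p using Polynomial.induction_on' with
    | add p q hp hq =>
      obtain ⟨h1, h1'⟩ := hp
      obtain ⟨h2, h2'⟩ := hq
      have h3 := (regularRing w).add_mem h1 h2
      rw [← Polynomial.eval₂_add] at h3
      refine ⟨h3, ?_⟩
      rw [Polynomial.eval_add, map_add, ← h1', ← h2', ← map_add]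
      congr 1
      exact Subtype.ext (Polynomial.eval₂_add _ _)
    | monomial k a =>
      have h3 := (regularRing w).mul_mem (C_mem_regularRing w (starRingEnd ℂ a))
        ((regularRing w).pow_mem hX.1 k)
      have h4 : (Polynomial.monomial k a).eval₂
          ((RatFunc.C : ℂ →+* RatFunc ℂ).comp (starRingEnd ℂ)) (RatFunc.X)⁻¹ =
          RatFunc.C (starRingEnd ℂ a) * ((RatFunc.X)⁻¹ ^ k) := by
        simp [Polynomial.eval₂_monomial]
      refine ⟨h4 ▸ h3, ?_⟩
      have h5 : (⟨_, h4 ▸ h3⟩ : regularRing w) =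
          ⟨_, C_mem_regularRing w (starRingEnd ℂ a)⟩ * ⟨_, hX.1⟩ ^ k := Subtype.ext h4
      refine (congrArg (evalAt w) h5).trans ?_
      rw [map_mul, map_pow]
      change RatFunc.eval _ _ (RatFunc.C _) * (RatFunc.eval _ _ (RatFunc.X)⁻¹) ^ k = _
      rw [hX.2]
      simp [hwi]
  obtain ⟨h1, h1'⟩ := key f.num
  obtain ⟨h2, h2'⟩ := key f.denom
  have h3 := inv_mem_regularRing h2 (by
    change evalAt w ⟨_, h2⟩ ≠ 0
    rw [h2']
    simpa using mem_regularRing.1 hf)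
  have h4 := (evalAt w).map_mul ⟨_, h1⟩ ⟨_, h3.1⟩
  refine ⟨by
    rw [paraConjFun, RatFunc.eval, div_eq_mul_inv]
    exact (regularRing w).mul_mem h1 h3.1, ?_⟩
  rw [paraConjFun, RatFunc.eval.eq_1 _ _ f, div_eq_mul_inv]
  refine h4.trans ?_
  rw [h1']
  change _ * RatFunc.eval _ _ _ = _
  rw [h3.2]
  change _ * (evalAt w ⟨_, h2⟩)⁻¹ = _
  rw [h2', RatFunc.eval, map_div₀, div_eq_mul_inv]
  rfl

/-! ### Evaluation of rational matrix functions -/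

/-- Without a pole at `w`, a matrix lifts to the local ring at `w`, so that its evaluation commutes
with all ring operations. -/
theorem not_isPole_iff {k l : ℕ} {Ω : RatMat k l} {w : ℂ} :
    ¬ IsPole Ω w ↔ ∃ Ω' : Matrix (Fin k) (Fin l) (regularRing w),
      Ω = Ω'.map (regularRing w).subtype := by
  constructor
  · intro h
    refine ⟨Matrix.of fun i j => ⟨Ω i j, fun h0 => h ⟨i, j, h0⟩⟩, ?_⟩
    ext i j
    rfl
  · rintro ⟨Ω', rfl⟩ ⟨i, j, h⟩
    exact (Ω' i j).2 h

theorem evalMat_map {k l : ℕ} {w : ℂ} (Ω' : Matrix (Fin k) (Fin l) (regularRing w)) :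
    evalMat (Ω'.map (regularRing w).subtype) w = Ω'.map (evalAt w) := rfl

theorem evalMat_mul {k l p : ℕ} {Ω₁ : RatMat k l} {Ω₂ : RatMat l p} {w : ℂ}
    (h₁ : ¬ IsPole Ω₁ w) (h₂ : ¬ IsPole Ω₂ w) :
    ¬ IsPole (Ω₁ * Ω₂) w ∧ evalMat (Ω₁ * Ω₂) w = evalMat Ω₁ w * evalMat Ω₂ w := by
  obtain ⟨Ω₁, rfl⟩ := not_isPole_iff.1 h₁
  obtain ⟨Ω₂, rfl⟩ := not_isPole_iff.1 h₂
  rw [← Matrix.map_mul]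
  exact ⟨not_isPole_iff.2 ⟨_, rfl⟩, by
    rw [evalMat_map, evalMat_map, evalMat_map, Matrix.map_mul]⟩

theorem evalMat_add {k l : ℕ} {Ω₁ Ω₂ : RatMat k l} {w : ℂ}
    (h₁ : ¬ IsPole Ω₁ w) (h₂ : ¬ IsPole Ω₂ w) :
    ¬ IsPole (Ω₁ + Ω₂) w ∧ evalMat (Ω₁ + Ω₂) w = evalMat Ω₁ w + evalMat Ω₂ w := by
  obtain ⟨Ω₁, rfl⟩ := not_isPole_iff.1 h₁
  obtain ⟨Ω₂, rfl⟩ := not_isPole_iff.1 h₂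
  rw [← Matrix.map_add _ (map_add _)]
  exact ⟨not_isPole_iff.2 ⟨_, rfl⟩, by
    rw [evalMat_map, evalMat_map, evalMat_map, Matrix.map_add _ (map_add _)]⟩

theorem evalMat_sub {k l : ℕ} {Ω₁ Ω₂ : RatMat k l} {w : ℂ}
    (h₁ : ¬ IsPole Ω₁ w) (h₂ : ¬ IsPole Ω₂ w) :
    ¬ IsPole (Ω₁ - Ω₂) w ∧ evalMat (Ω₁ - Ω₂) w = evalMat Ω₁ w - evalMat Ω₂ w := by
  obtain ⟨Ω₁, rfl⟩ := not_isPole_iff.1 h₁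
  obtain ⟨Ω₂, rfl⟩ := not_isPole_iff.1 h₂
  rw [← Matrix.map_sub _ (map_sub _)]
  exact ⟨not_isPole_iff.2 ⟨_, rfl⟩, by
    rw [evalMat_map, evalMat_map, evalMat_map, Matrix.map_sub _ (map_sub _)]⟩

theorem evalMat_constMat {k l : ℕ} (M : Matrix (Fin k) (Fin l) ℂ) (w : ℂ) :
    ¬ IsPole (constMat M) w ∧ evalMat (constMat M) w = M := by
  refine ⟨?_, by ext i j; simp [evalMat, constMat]⟩
  rintro ⟨i, j, h⟩
  exact C_mem_regularRing w (M i j) h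

theorem evalMat_X_smul {k l : ℕ} {Ω : RatMat k l} {w : ℂ} (h : ¬ IsPole Ω w) :
    ¬ IsPole ((RatFunc.X : RatFunc ℂ) • Ω) w ∧
      evalMat ((RatFunc.X : RatFunc ℂ) • Ω) w = w • evalMat Ω w := by
  obtain ⟨Ω, rfl⟩ := not_isPole_iff.1 h
  have h1 : (RatFunc.X : RatFunc ℂ) • Ω.map (regularRing w).subtype =
      ((⟨_, X_mem_regularRing w⟩ : regularRing w) • Ω).map (regularRing w).subtype := by
    ext i j; simp
  refine ⟨not_isPole_iff.2 ⟨_, h1⟩, ?_⟩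
  rw [h1, evalMat_map, evalMat_map]
  ext i j
  simp only [Matrix.map_apply, Matrix.smul_apply, smul_eq_mul, map_mul]
  congr 1
  exact RatFunc.eval_X _ _

theorem constMat_one (k : ℕ) : constMat (1 : Matrix (Fin k) (Fin k) ℂ) = 1 := by
  simp [constMat]

theorem evalMat_one (k : ℕ) (w : ℂ) :
    ¬ IsPole (1 : RatMat k k) w ∧ evalMat (1 : RatMat k k) w = 1 := by
  rw [← constMat_one]
  exact evalMat_constMat 1 w

theorem evalMat_inv {k : ℕ} {Ω : RatMat k k} {w : ℂ} (h : ¬ IsPole Ω w)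
    (hu : IsUnit (evalMat Ω w).det) :
    ¬ IsPole Ω⁻¹ w ∧ evalMat Ω⁻¹ w = (evalMat Ω w)⁻¹ := by
  obtain ⟨Ω', rfl⟩ := not_isPole_iff.1 h
  rw [evalMat_map] at hu
  have hd : (Ω'.map (regularRing w).subtype).det = (Ω'.det : RatFunc ℂ) :=
    ((regularRing w).subtype.map_det Ω').symm
  have hd' : RatFunc.eval (RingHom.id ℂ) w (Ω'.det : RatFunc ℂ) ≠ 0 := by
    change evalAt w Ω'.det ≠ 0
    rw [RingHom.map_det]
    exact hu.ne_zero
  have hi := inv_mem_regularRing Ω'.det.2 hd'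
  have hne : (Ω'.map (regularRing w).subtype).det ≠ 0 := by
    rw [hd]; intro h0; rw [h0] at hd'; simp at hd'
  have hreg : ¬ IsPole (Ω'.map (regularRing w).subtype)⁻¹ w := by
    refine not_isPole_iff.2 ⟨(⟨_, hi.1⟩ : regularRing w) • Ω'.adjugate, ?_⟩
    rw [Matrix.inv_def, hd, Ring.inverse_eq_inv']
    have := (regularRing w).subtype.map_adjugate Ω'
    simp only [RingHom.mapMatrix_apply] at this
    rw [← this]
    ext i j
    simp
  refine ⟨hreg, (Matrix.inv_eq_left_inv ?_).symm⟩
  rw [← (evalMat_mul hreg h).2, Matrix.nonsing_inv_mul _ (isUnit_iff_ne_zero.2 hne)]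
  exact (evalMat_one k w).2

theorem evalMat_paraConj {k l : ℕ} {Ω : RatMat k l} {w : ℂ} (hw : ‖w‖ = 1) (h : ¬ IsPole Ω w) :
    ¬ IsPole (paraConj Ω) w ∧ evalMat (paraConj Ω) w = (evalMat Ω w)ᴴ := by
  have h' : ∀ i j, Ω i j ∈ regularRing w := fun i j h0 => h ⟨i, j, h0⟩
  refine ⟨?_, ?_⟩
  · rintro ⟨i, j, h0⟩
    exact (paraConjFun_eval hw (h' j i)).1 h0
  · ext i j
    exact (paraConjFun_eval hw (h' j i)).2

theorem RatMat.eq_of_evalMat_circle_eq {k l : ℕ} {Ω₁ Ω₂ : RatMat k l}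
    (h₁ : ∀ w : ℂ, ‖w‖ = 1 → ¬ IsPole Ω₁ w) (h₂ : ∀ w : ℂ, ‖w‖ = 1 → ¬ IsPole Ω₂ w)
    (h : ∀ w : ℂ, ‖w‖ = 1 → evalMat Ω₁ w = evalMat Ω₂ w) : Ω₁ = Ω₂ := by
  ext i j : 2
  exact RatFunc.eq_of_eval_circle_eq (fun w hw h0 => h₁ w hw ⟨i, j, h0⟩)
    (fun w hw h0 => h₂ w hw ⟨i, j, h0⟩) fun w hw => congrFun (congrFun (h w hw) i) j

theorem IsStableRational.not_isPole_circle {k l : ℕ} {Ω : RatMat k l} (h : IsStableRational Ω) :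
    ∀ w : ℂ, ‖w‖ = 1 → ¬ IsPole Ω w := fun w hw => h w hw.le

section
open scoped Matrix.Norms.L2Operator

/-- The resolvent series of a stable matrix, on the closed unit disc. -/
theorem IsStableMat.hasSum_resolvent {n : ℕ} {A : Matrix (Fin n) (Fin n) ℂ} (hA : IsStableMat A)
    {w : ℂ} (hw : ‖w‖ ≤ 1) :
    IsUnit (1 - w • A).det ∧ HasSum (fun ν : ℕ => w ^ ν • A ^ ν) (1 - w • A)⁻¹ := by
  have hs : Summable fun ν : ℕ => (w • A) ^ ν := by
    refine Summable.of_norm_bounded hA.summable_norm_pow fun ν => ?_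
    rw [smul_pow, norm_smul, norm_pow]
    exact mul_le_of_le_one_left (norm_nonneg _) (pow_le_one₀ (norm_nonneg _) hw)
  have h1 := hs.one_sub_mul_tsum_pow
  refine ⟨Matrix.isUnit_det_of_right_inverse h1, ?_⟩
  rw [Matrix.inv_eq_right_inv h1]
  simpa only [smul_pow] using hs.hasSum

end

theorem evalMat_resolvent {n : ℕ} {A : Matrix (Fin n) (Fin n) ℂ} (hA : IsStableMat A)
    {w : ℂ} (hw : ‖w‖ ≤ 1) :
    ¬ IsPole (1 - (RatFunc.X : RatFunc ℂ) • constMat A)⁻¹ w ∧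
      evalMat (1 - (RatFunc.X : RatFunc ℂ) • constMat A)⁻¹ w = (1 - w • A)⁻¹ := by
  have hX := evalMat_X_smul (evalMat_constMat A w).1
  have h1 := evalMat_sub (evalMat_one n w).1 hX.1
  have h2 : evalMat (1 - (RatFunc.X : RatFunc ℂ) • constMat A) w = 1 - w • A := by
    rw [h1.2, hX.2, (evalMat_one n w).2, (evalMat_constMat A w).2]
  have h3 := evalMat_inv h1.1 (h2 ▸ (hA.hasSum_resolvent hw).1)
  exact ⟨h3.1, h3.2.trans (by rw [h2])⟩

theorem evalMat_realization {k l n : ℕ} {A : Matrix (Fin n) (Fin n) ℂ} (hA : IsStableMat A)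
    (D : Matrix (Fin k) (Fin l) ℂ) (C : Matrix (Fin k) (Fin n) ℂ) (B : Matrix (Fin n) (Fin l) ℂ)
    {w : ℂ} (hw : ‖w‖ ≤ 1) :
    ¬ IsPole (realization D C A B) w ∧
      evalMat (realization D C A B) w = D + w • (C * (1 - w • A)⁻¹ * B) := by
  have h1 := evalMat_resolvent hA hw
  have h2 := evalMat_mul (evalMat_constMat C w).1 h1.1
  have h3 := evalMat_mul h2.1 (evalMat_constMat B w).1
  have h4 := evalMat_X_smul h3.1
  have h5 := evalMat_add (evalMat_constMat D w).1 h4.1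
  refine ⟨h5.1, h5.2.trans ?_⟩
  rw [h4.2, h3.2, h2.2, h1.2]
  simp only [(evalMat_constMat _ w).2]

theorem isStableRational_realization {k l n : ℕ} {A : Matrix (Fin n) (Fin n) ℂ}
    (hA : IsStableMat A) (D : Matrix (Fin k) (Fin l) ℂ) (C : Matrix (Fin k) (Fin n) ℂ)
    (B : Matrix (Fin n) (Fin l) ℂ) : IsStableRational (realization D C A B) :=
  fun _ hw => (evalMat_realization hA D C B hw).1

/-- On the unit circle `R(w) = G(w) + R₀ + G(w)ᴴ` with `G(z) = z C (I - z A)⁻¹ Γ`. -/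
theorem evalMat_spectralFunction {m n : ℕ} {A : Matrix (Fin n) (Fin n) ℂ} (hA : IsStableMat A)
    (C : Matrix (Fin m) (Fin n) ℂ) (Γ : Matrix (Fin n) (Fin m) ℂ) (R₀ : Matrix (Fin m) (Fin m) ℂ)
    {w : ℂ} (hw : ‖w‖ = 1) :
    ¬ IsPole (spectralFunction A C Γ R₀) w ∧
      evalMat (spectralFunction A C Γ R₀) w = evalMat (realization R₀ C A Γ) w +
        (evalMat (realization 0 C A Γ) w)ᴴ := by
  have h1 := evalMat_resolvent hA hw.le
  have h2 := evalMat_mul (evalMat_constMat C w).1 h1.1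
  have h3 := evalMat_mul h2.1 (evalMat_constMat Γ w).1
  have h4 := evalMat_X_smul h3.1
  have h5 := evalMat_add h4.1 (evalMat_constMat R₀ w).1
  have hX := evalMat_X_smul (evalMat_one n w).1
  have h6 := evalMat_sub hX.1 (evalMat_constMat Aᴴ w).1
  have h7 : evalMat ((RatFunc.X : RatFunc ℂ) • (1 : RatMat n n) - constMat Aᴴ) w =
      w • (1 - w • A)ᴴ := by
    rw [h6.2, hX.2, (evalMat_one n w).2, (evalMat_constMat _ w).2]
    have : w * starRingEnd ℂ w = 1 := by
      rw [Complex.mul_conj, Complex.normSq_eq_norm_sq, hw]; simp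
    rw [Matrix.conjTranspose_sub, Matrix.conjTranspose_smul, smul_sub, smul_smul]
    simp [this]
  have hw0 : w ≠ 0 := by rintro rfl; simp at hw
  have hu : IsUnit (w • (1 - w • A)ᴴ).det := by
    rw [Matrix.det_smul, Matrix.det_conjTranspose]
    exact ((isUnit_iff_ne_zero.2 hw0).pow _).mul (hA.hasSum_resolvent hw.le).1.star
  have h8 := evalMat_inv h6.1 (h7 ▸ hu)
  have h9 := evalMat_mul (evalMat_constMat Γᴴ w).1 h8.1
  have h10 := evalMat_mul h9.1 (evalMat_constMat Cᴴ w).1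
  have h11 := evalMat_add h5.1 h10.1
  refine ⟨h11.1, h11.2.trans ?_⟩
  have hinv : (w • (1 - w • A)ᴴ)⁻¹ = star w • ((1 - w • A)⁻¹)ᴴ := by
    refine Matrix.inv_eq_left_inv ?_
    rw [Matrix.smul_mul, Matrix.mul_smul, smul_smul, ← Matrix.conjTranspose_mul,
      Matrix.mul_nonsing_inv _ (hA.hasSum_resolvent hw.le).1]
    have : starRingEnd ℂ w * w = 1 := by
      rw [mul_comm, Complex.mul_conj, Complex.normSq_eq_norm_sq, hw]; simp
    simp [this]
  rw [h5.2, h4.2, h3.2, h2.2, h1.2, h10.2, h9.2, h8.2, h7, hinv,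
    (evalMat_realization hA R₀ C Γ hw.le).2, (evalMat_realization hA 0 C Γ hw.le).2]
  simp only [(evalMat_constMat _ w).2, zero_add, Matrix.conjTranspose_smul,
    Matrix.conjTranspose_mul, Matrix.mul_smul, Matrix.smul_mul, Matrix.mul_assoc]
  abel


/-! ### Fourier coefficients -/

/-- The `s`-th Fourier coefficient, as a bounded functional on the continuous functions. -/
def fourierCoeffCLM (s : ℤ) : C(UnitAddCircle, ℂ) →L[ℂ] ℂ :=
  innerSL ℂ (fourierLp (T := (1 : ℝ)) 2 s) ∘L ContinuousMap.toLp 2 AddCircle.haarAddCircle ℂ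

theorem inner_fourierLp_toLp (f : C(UnitAddCircle, ℂ)) (s : ℤ) :
    ⟪fourierLp (T := (1 : ℝ)) 2 s, ContinuousMap.toLp 2 AddCircle.haarAddCircle ℂ f⟫_ℂ =
      fourierCoeff f s := by
  have h := fourierBasis_repr (T := (1 : ℝ))
    (ContinuousMap.toLp (E := ℂ) 2 AddCircle.haarAddCircle ℂ f) s
  rwa [HilbertBasis.repr_apply_apply, coe_fourierBasis, fourierCoeff_toLp] at h

theorem fourierCoeffCLM_apply (s : ℤ) (f : C(UnitAddCircle, ℂ)) :
    fourierCoeffCLM s f = fourierCoeff f s :=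
  inner_fourierLp_toLp f s

theorem eq_of_fourierCoeff_eq {f g : C(UnitAddCircle, ℂ)}
    (h : ∀ s, fourierCoeff f s = fourierCoeff g s) : f = g := by
  refine ContinuousMap.toLp_injective (p := 2) (𝕜 := ℂ) AddCircle.haarAddCircle ?_
  refine (fourierBasis (T := (1 : ℝ))).repr.injective ?_
  ext s
  rw [fourierBasis_repr, fourierBasis_repr, fourierCoeff_toLp, fourierCoeff_toLp, h]

theorem toCircle_pow_eq_fourier (t : UnitAddCircle) (k : ℕ) :
    (t.toCircle : ℂ) ^ k = fourier (k : ℤ) t := by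
  induction k with
  | zero => simp
  | succ k ih =>
    rw [pow_succ, ih]
    push_cast
    rw [fourier_add, fourier_one]

/-- The Fourier coefficients of the boundary values of an absolutely convergent power series. -/
theorem fourierCoeff_of_hasSum {c : ℕ → ℂ} (hc : Summable fun ν => ‖c ν‖) {g : UnitAddCircle → ℂ}
    (hg : ∀ t : UnitAddCircle, HasSum (fun ν => c ν * (t.toCircle : ℂ) ^ ν) (g t)) (ν : ℕ) :
    fourierCoeff g ν = c ν := by
  have hs : Summable fun ν : ℕ => c ν • fourier (T := (1 : ℝ)) (ν : ℤ) := by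
    refine Summable.of_norm ?_
    simpa only [norm_smul, fourier_norm, mul_one] using hc
  have h1 : ∀ t, (∑' ν : ℕ, c ν • fourier (T := (1 : ℝ)) (ν : ℤ)) t = g t := fun t => by
    have h2 := hs.hasSum.mapL (ContinuousMap.evalCLM ℂ t)
    refine h2.unique ?_
    convert hg t using 2 with ν
    simp only [toCircle_pow_eq_fourier]
    rfl
  have h3 := hs.hasSum.mapL (fourierCoeffCLM ν)
  rw [fourierCoeffCLM_apply, funext h1] at h3
  refine h3.unique ?_
  have h4 : ∀ k : ℕ, fourierCoeffCLM ν (c k • fourier (T := (1 : ℝ)) (k : ℤ)) =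
      if k = ν then c ν else 0 := fun k => by
    rw [map_smul, fourierCoeffCLM_apply, fourierCoeff_fourier, Pi.single_apply]
    by_cases h : k = ν
    · subst h; simp
    · simp [h, Ne.symm h]
  simp only [h4]
  exact hasSum_ite_eq ν (c ν)

theorem fourierCoeff_conj (f : UnitAddCircle → ℂ) (s : ℤ) :
    fourierCoeff (fun t => starRingEnd ℂ (f t)) s = starRingEnd ℂ (fourierCoeff f (-s)) := by
  rw [fourierCoeff, fourierCoeff, ← integral_conj]
  refine MeasureTheory.integral_congr_ae (Filter.Eventually.of_forall fun t => ?_)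
  simp only [smul_eq_mul, map_mul, ← fourier_neg, neg_neg]

/-- Parseval's identity. -/
theorem hasSum_conj_fourierCoeff_mul (f g : C(UnitAddCircle, ℂ)) (i j : ℤ) :
    HasSum (fun k : ℤ => starRingEnd ℂ (fourierCoeff f (k - i)) * fourierCoeff g (k - j))
      (fourierCoeff (fun t => starRingEnd ℂ (f t) * g t) (i - j)) := by
  have hshift : ∀ (f : C(UnitAddCircle, ℂ)) (i k : ℤ),
      fourierCoeff (fourier i * f : C(UnitAddCircle, ℂ)) k = fourierCoeff f (k - i) := by
    intro f i k
    refine MeasureTheory.integral_congr_ae (Filter.Eventually.of_forall fun t => ?_)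
    have : -(k - i) = -k + i := by ring
    simp only [this, fourier_add, smul_eq_mul, ContinuousMap.mul_apply]
    ring
  have h := (fourierBasis (T := (1 : ℝ))).hasSum_inner_mul_inner
    (ContinuousMap.toLp (E := ℂ) 2 AddCircle.haarAddCircle ℂ (fourier i * f))
    (ContinuousMap.toLp (E := ℂ) 2 AddCircle.haarAddCircle ℂ (fourier j * g))
  rw [MeasureTheory.ContinuousMap.inner_toLp] at h
  have e1 : (fun k : ℤ => starRingEnd ℂ (fourierCoeff f (k - i)) * fourierCoeff g (k - j)) =
      fun k => ⟪ContinuousMap.toLp (E := ℂ) 2 AddCircle.haarAddCircle ℂ (fourier i * f),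
          fourierBasis (T := (1 : ℝ)) k⟫_ℂ * ⟪fourierBasis (T := (1 : ℝ)) k,
          ContinuousMap.toLp (E := ℂ) 2 AddCircle.haarAddCircle ℂ (fourier j * g)⟫_ℂ := by
    funext k
    rw [coe_fourierBasis, inner_fourierLp_toLp, hshift, ← inner_conj_symm, inner_fourierLp_toLp,
      hshift]
  have e2 : fourierCoeff (fun t => starRingEnd ℂ (f t) * g t) (i - j) =
      ∫ t : AddCircle (1 : ℝ), (fourier j * g : C(UnitAddCircle, ℂ)) t *
        starRingEnd ℂ ((fourier i * f : C(UnitAddCircle, ℂ)) t)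
        ∂AddCircle.haarAddCircle := by
    refine MeasureTheory.integral_congr_ae (Filter.Eventually.of_forall fun t => ?_)
    have : -(i - j) = -i + j := by ring
    simp only [this, fourier_add, fourier_neg, smul_eq_mul, ContinuousMap.mul_apply, map_mul]
    ring
  rw [e1, e2]
  exact h

/-- The mean value property on the unit disc, in terms of Fourier coefficients. -/
theorem fourierCoeff_neg_of_diffContOnCl {f : ℂ → ℂ} (hf : DiffContOnCl ℂ f (Metric.ball 0 1))
    (k : ℕ) : fourierCoeff (fun t : UnitAddCircle => f (t.toCircle : ℂ)) (-k) = 0 ^ k * f 0 := by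
  have hd : DiffContOnCl ℂ (fun z : ℂ => z ^ k * f z) (Metric.ball 0 |1|) := by
    rw [abs_one]
    exact (Differentiable.diffContOnCl (by fun_prop : Differentiable ℂ fun z : ℂ => z ^ k)).smul hf
  have h := hd.circleAverage
  rw [← h, fourierCoeff_eq_intervalIntegral _ _ 0, Real.circleAverage_def]
  have h2 : ∀ x : ℝ, fourier (T := (1 : ℝ)) (- -(k : ℤ)) (x : UnitAddCircle) •
      f (AddCircle.toCircle (T := (1 : ℝ)) x : ℂ) =
      (fun θ : ℝ => circleMap 0 1 θ ^ k * f (circleMap 0 1 θ)) (2 * Real.pi * x) := fun x => by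
    have h3 : (AddCircle.toCircle (T := (1 : ℝ)) x : ℂ) = circleMap 0 1 (2 * Real.pi * x) := by
      rw [AddCircle.toCircle_apply_mk, Circle.coe_exp]
      simp [circleMap]
    rw [neg_neg, ← toCircle_pow_eq_fourier, h3, smul_eq_mul]
  simp only [h2]
  rw [intervalIntegral.integral_comp_mul_left
    (fun θ : ℝ => circleMap 0 1 θ ^ k * f (circleMap 0 1 θ)) (by positivity)]
  simp

/-! ### Fourier coefficients of rational matrix functions -/

theorem continuous_evalMat {k l : ℕ} {Ω : RatMat k l} (hΩ : ∀ w : ℂ, ‖w‖ = 1 → ¬ IsPole Ω w)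
    (a : Fin k) (b : Fin l) :
    Continuous fun t : UnitAddCircle => evalMat Ω (t.toCircle : ℂ) a b := by
  have h1 : Continuous fun t : UnitAddCircle => (t.toCircle : ℂ) :=
    continuous_subtype_val.comp AddCircle.continuous_toCircle
  have h2 : ∀ p : Polynomial ℂ,
      Continuous fun t : UnitAddCircle => Polynomial.eval₂ (RingHom.id ℂ) (t.toCircle : ℂ) p :=
    fun p => p.continuous.comp h1
  exact (h2 _).div (h2 _) fun t h0 => hΩ _ (Circle.norm_coe _) ⟨a, b, h0⟩

theorem fourierBlock_apply {k l : ℕ} (Ω : RatMat k l) (s : ℤ) (a : Fin k) (b : Fin l) :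
    fourierBlock Ω s a b =
      fourierCoeff (fun t : UnitAddCircle => evalMat Ω (t.toCircle : ℂ) a b) s := rfl

/-- A rational matrix function without poles on the unit circle is determined by its Fourier
coefficients. -/
theorem RatMat.eq_of_fourierBlock_eq {k l : ℕ} {Ω₁ Ω₂ : RatMat k l}
    (h₁ : ∀ w : ℂ, ‖w‖ = 1 → ¬ IsPole Ω₁ w) (h₂ : ∀ w : ℂ, ‖w‖ = 1 → ¬ IsPole Ω₂ w)
    (h : ∀ s, fourierBlock Ω₁ s = fourierBlock Ω₂ s) : Ω₁ = Ω₂ := by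
  refine RatMat.eq_of_evalMat_circle_eq h₁ h₂ fun w hw => ?_
  obtain ⟨t, ht⟩ := (AddCircle.homeomorphCircle (T := (1 : ℝ)) one_ne_zero).surjective
    ⟨w, by simpa [Submonoid.unitSphere] using hw⟩
  rw [AddCircle.homeomorphCircle_apply] at ht
  have ht' : (t.toCircle : ℂ) = w := congrArg Subtype.val ht
  ext a b
  have := eq_of_fourierCoeff_eq (f := ⟨_, continuous_evalMat h₁ a b⟩)
    (g := ⟨_, continuous_evalMat h₂ a b⟩) fun s => congrFun (congrFun (h s) a) b
  rw [← ht']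
  exact DFunLike.congr_fun this t

theorem IsStableRational.diffContOnCl {k l : ℕ} {Ω : RatMat k l} (hΩ : IsStableRational Ω)
    (a : Fin k) (b : Fin l) : DiffContOnCl ℂ (fun w => evalMat Ω w a b) (Metric.ball 0 1) := by
  refine DifferentiableOn.diffContOnCl ?_
  rw [closure_ball _ one_ne_zero]
  refine DifferentiableOn.fun_div (Ω a b).num.differentiable.differentiableOn
    (Ω a b).denom.differentiable.differentiableOn fun w hw h0 => ?_
  exact hΩ w (by simpa using hw) ⟨a, b, h0⟩

theorem IsStableRational.fourierBlock_neg {k l : ℕ} {Ω : RatMat k l} (hΩ : IsStableRational Ω)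
    {s : ℤ} (hs : s < 0) : fourierBlock Ω s = 0 := by
  ext a b
  obtain ⟨j, rfl⟩ : ∃ j : ℕ, s = -((j + 1 : ℕ) : ℤ) := ⟨(-s - 1).toNat, by omega⟩
  refine (fourierCoeff_neg_of_diffContOnCl (hΩ.diffContOnCl a b) (j + 1)).trans ?_
  simp

theorem IsStableRational.fourierBlock_zero {k l : ℕ} {Ω : RatMat k l} (hΩ : IsStableRational Ω) :
    fourierBlock Ω 0 = evalMat Ω 0 := by
  ext a b
  have h := fourierCoeff_neg_of_diffContOnCl (hΩ.diffContOnCl a b) 0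
  rw [Nat.cast_zero, neg_zero, pow_zero, one_mul] at h
  exact h

section
open scoped Matrix.Norms.L2Operator

/-- The resolvent series of `A` is the Fourier series of the realization on the unit circle. -/
theorem fourierBlock_realization {k l n : ℕ} {A : Matrix (Fin n) (Fin n) ℂ}
    (hA : IsStableMat A) (D : Matrix (Fin k) (Fin l) ℂ) (C : Matrix (Fin k) (Fin n) ℂ)
    (B : Matrix (Fin n) (Fin l) ℂ) (ν : ℕ) :
    fourierBlock (realization D C A B) (ν + 1) = C * A ^ ν * B := by
  have hsum : Summable fun ν : ℕ => ‖C * A ^ ν * B‖ := by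
    refine ((hA.summable_norm_pow.mul_left ‖C‖).mul_right ‖B‖).of_nonneg_of_le
      (fun _ => norm_nonneg _) fun ν => ?_
    exact (Matrix.l2_opNorm_mul _ _).trans
      (mul_le_mul_of_nonneg_right (Matrix.l2_opNorm_mul _ _) (norm_nonneg _))
  ext a b
  have hentry : Continuous fun M : Matrix (Fin k) (Fin l) ℂ => M a b :=
    (continuous_apply b).comp (continuous_apply a)
  let c : ℕ → ℂ := fun ν => Nat.casesOn ν (D a b) fun ν => (C * A ^ ν * B) a b
  have hc : Summable fun ν => ‖c ν‖ := by
    rw [← summable_nat_add_iff 1]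
    exact ((Summable.of_norm hsum).map ({ toFun := fun M => M a b
                                          map_zero' := rfl
                                          map_add' := fun _ _ => rfl } :
      Matrix (Fin k) (Fin l) ℂ →+ ℂ) hentry).norm
  refine fourierCoeff_of_hasSum hc (fun t => ?_) (ν + 1)
  have hw : ‖(t.toCircle : ℂ)‖ ≤ 1 := (Circle.norm_coe _).le
  rw [(evalMat_realization hA D C B hw).2]
  have h1 := (hA.hasSum_resolvent hw).2
  have h2 : HasSum (fun ν : ℕ => (C * ((t.toCircle : ℂ) ^ ν • A ^ ν) * B) a b)
      ((C * (1 - (t.toCircle : ℂ) • A)⁻¹ * B) a b) := by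
    have hcont : Continuous fun M : Matrix (Fin n) (Fin n) ℂ => (C * M * B) a b := by
      fun_prop
    exact h1.map ({ toFun := fun M => (C * M * B) a b
                    map_zero' := by simp
                    map_add' := fun M N => by simp [Matrix.mul_add, Matrix.add_mul] } :
      Matrix (Fin n) (Fin n) ℂ →+ ℂ) hcont
  have h3 := h2.mul_left (t.toCircle : ℂ)
  rw [← hasSum_nat_add_iff' 1]
  have e1 : (fun ν => c (ν + 1) * (t.toCircle : ℂ) ^ (ν + 1)) =
      fun ν => (t.toCircle : ℂ) * (C * ((t.toCircle : ℂ) ^ ν • A ^ ν) * B) a b := by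
    funext ν
    simp only [c, Matrix.mul_smul, Matrix.smul_mul, Matrix.smul_apply, smul_eq_mul]
    ring
  have e2 : (D + (t.toCircle : ℂ) • (C * (1 - (t.toCircle : ℂ) • A)⁻¹ * B)) a b -
      ∑ i ∈ Finset.range 1, c i * (t.toCircle : ℂ) ^ i =
      (t.toCircle : ℂ) * (C * (1 - (t.toCircle : ℂ) • A)⁻¹ * B) a b := by
    simp [c]
  rw [e1, e2]
  exact h3

end

theorem fourierBlock_spectralFunction {m n : ℕ} {A : Matrix (Fin n) (Fin n) ℂ}
    (hA : IsStableMat A) (C : Matrix (Fin m) (Fin n) ℂ) (Γ : Matrix (Fin n) (Fin m) ℂ)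
    (R₀ : Matrix (Fin m) (Fin m) ℂ) (ν : ℕ) :
    fourierBlock (spectralFunction A C Γ R₀) (ν + 1) = C * A ^ ν * Γ := by
  have hG := isStableRational_realization hA R₀ C Γ
  have hG' := isStableRational_realization hA 0 C Γ
  ext a b
  have h1 : (fun t : UnitAddCircle => evalMat (spectralFunction A C Γ R₀) (t.toCircle : ℂ) a b) =
      (⟨_, continuous_evalMat hG.not_isPole_circle a b⟩ +
        star ⟨_, continuous_evalMat hG'.not_isPole_circle b a⟩ : C(UnitAddCircle, ℂ)) := by
    ext t
    rw [(evalMat_spectralFunction hA C Γ R₀ (Circle.norm_coe _)).2]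
    rfl
  rw [fourierBlock_apply]
  rw [h1, ← fourierCoeffCLM_apply, map_add, fourierCoeffCLM_apply, fourierCoeffCLM_apply,
    ← fourierBlock_realization hA R₀ C Γ ν]
  refine add_eq_left.2 ((fourierCoeff_conj _ _).trans ?_)
  rw [map_eq_zero]
  exact congrFun (congrFun (hG'.fourierBlock_neg (s := -((ν : ℤ) + 1)) (by omega)) b) a

theorem not_isPole_paraConj_mul {k l p : ℕ} {Ω₁ : RatMat k l} {Ω₂ : RatMat k p}
    (h₁ : IsStableRational Ω₁) (h₂ : IsStableRational Ω₂) :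
    ∀ w : ℂ, ‖w‖ = 1 → ¬ IsPole (paraConj Ω₁ * Ω₂) w := fun w hw =>
  (evalMat_mul (evalMat_paraConj hw (h₁ w hw.le)).1 (h₂ w hw.le)).1

/-- Parseval's identity for the Fourier coefficients of `Ω₁^* Ω₂`. -/
theorem hasSum_fourierBlock_paraConj_mul {k l p : ℕ} {Ω₁ : RatMat k l} {Ω₂ : RatMat k p}
    (h₁ : IsStableRational Ω₁) (h₂ : IsStableRational Ω₂) (i j : ℤ) :
    HasSum (fun s : ℤ => (fourierBlock Ω₁ (s - i))ᴴ * fourierBlock Ω₂ (s - j))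
      (fourierBlock (paraConj Ω₁ * Ω₂) (i - j)) := by
  refine Pi.hasSum.2 fun a => Pi.hasSum.2 fun b => ?_
  let f : Fin k → C(UnitAddCircle, ℂ) := fun c => ⟨_, continuous_evalMat h₁.not_isPole_circle c a⟩
  let g : Fin k → C(UnitAddCircle, ℂ) := fun c => ⟨_, continuous_evalMat h₂.not_isPole_circle c b⟩
  have h := hasSum_sum fun c (_ : c ∈ Finset.univ) => hasSum_conj_fourierCoeff_mul (f c) (g c) i j
  have h3 : (fun t : UnitAddCircle => evalMat (paraConj Ω₁ * Ω₂) (t.toCircle : ℂ) a b) =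
      (∑ c, star (f c) * g c : C(UnitAddCircle, ℂ)) := by
    ext t
    have hw : ‖(t.toCircle : ℂ)‖ = 1 := Circle.norm_coe _
    have hp := evalMat_paraConj hw (h₁.not_isPole_circle _ hw)
    rw [(evalMat_mul hp.1 (h₂.not_isPole_circle _ hw)).2, hp.2, ContinuousMap.coe_sum,
      Finset.sum_apply]
    rfl
  have h4 : fourierBlock (paraConj Ω₁ * Ω₂) (i - j) a b =
      ∑ c, fourierCoeff (fun t => starRingEnd ℂ (f c t) * g c t) (i - j) := by
    rw [fourierBlock_apply, h3, ← fourierCoeffCLM_apply, map_sum]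
    exact Finset.sum_congr rfl fun c _ => fourierCoeffCLM_apply _ _
  rw [h4]
  exact h


/-! ### Matrices as operators -/

theorem toEuclideanLin_mul_apply {k l p : ℕ} (M : Matrix (Fin k) (Fin l) ℂ)
    (N : Matrix (Fin l) (Fin p) ℂ) (x : EuclideanSpace ℂ (Fin p)) :
    Matrix.toEuclideanLin (M * N) x = Matrix.toEuclideanLin M (Matrix.toEuclideanLin N x) := by
  rw [Matrix.toEuclideanLin, Matrix.toLpLin_mul_same]
  rfl

theorem inner_toEuclideanLin_left {k l : ℕ} (M : Matrix (Fin k) (Fin l) ℂ)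
    (x : EuclideanSpace ℂ (Fin l)) (y : EuclideanSpace ℂ (Fin k)) :
    ⟪Matrix.toEuclideanLin M x, y⟫_ℂ = ⟪x, Matrix.toEuclideanLin Mᴴ y⟫_ℂ := by
  rw [Matrix.toEuclideanLin_conjTranspose_eq_adjoint, LinearMap.adjoint_inner_right]

/-! ### The shift operators -/

theorem tsum_norm_rpow_shift_le {k : ℕ} (x : L2plus k) :
    (Summable fun i => ‖x (i + 1)‖ ^ (2 : ℝ≥0∞).toReal) ∧
      ∑' i, ‖x (i + 1)‖ ^ (2 : ℝ≥0∞).toReal ≤ ∑' i, ‖x i‖ ^ (2 : ℝ≥0∞).toReal := by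
  have h := (memℓp_gen_iff (by norm_num)).1 x.2
  refine ⟨(summable_nat_add_iff 1).2 h, ?_⟩
  rw [h.tsum_eq_zero_add]
  exact le_add_of_nonneg_left (by positivity)

/-- The backward shift `(x₀, x₁, x₂, …) ↦ (x₁, x₂, …)` on `ℓ²₊(ℂᵏ)`. -/
def bshift (k : ℕ) : L2plus k →L[ℂ] L2plus k :=
  LinearMap.mkContinuous
    { toFun := fun x => ⟨fun i => x (i + 1),
        (memℓp_gen_iff (by norm_num)).2 (tsum_norm_rpow_shift_le x).1⟩
      map_add' := fun x y => by ext i; rfl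
      map_smul' := fun c x => by ext i; simp }
    1 (fun x => by
      rw [one_mul]
      refine lp.norm_le_of_tsum_le (by norm_num) (norm_nonneg _) ?_
      rw [lp.norm_rpow_eq_tsum (by norm_num)]
      exact (tsum_norm_rpow_shift_le x).2)

theorem bshift_apply {k : ℕ} (x : L2plus k) (i : ℕ) : bshift k x i = x (i + 1) := rfl

/-- The embedding of `ℂᵏ` into `ℓ²₊(ℂᵏ)` as the space of sequences `(u, 0, 0, …)`. -/
def embZero (k : ℕ) : EuclideanSpace ℂ (Fin k) →L[ℂ] L2plus k :=
  lp.singleContinuousLinearMap ℂ (fun _ : ℕ => EuclideanSpace ℂ (Fin k)) 2 0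

theorem embZero_apply {k : ℕ} (u : EuclideanSpace ℂ (Fin k)) :
    embZero k u = lp.single 2 0 u := rfl

theorem L2plus.inner_single_left {k : ℕ} (i : ℕ) (v : EuclideanSpace ℂ (Fin k)) (f : L2plus k) :
    ⟪(lp.single 2 i v : L2plus k), f⟫_ℂ = ⟪v, f i⟫_ℂ :=
  lp.inner_single_left (𝕜 := ℂ) (G := fun _ : ℕ => EuclideanSpace ℂ (Fin k)) i v f

theorem adjoint_embZero_apply {k : ℕ} (f : L2plus k) :
    ContinuousLinearMap.adjoint (embZero k) f = f 0 := by
  refine ext_inner_left ℂ fun v => ?_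
  rw [ContinuousLinearMap.adjoint_inner_right, embZero_apply, L2plus.inner_single_left]

theorem L2plus.inner_eq_add {k : ℕ} (f g : L2plus k) :
    ⟪f, g⟫_ℂ = ⟪f 0, g 0⟫_ℂ + ⟪bshift k f, bshift k g⟫_ℂ := by
  have h := lp.summable_inner (𝕜 := ℂ) (G := fun _ : ℕ => EuclideanSpace ℂ (Fin k)) f g
  exact (lp.inner_eq_tsum f g).trans (h.tsum_eq_zero_add.trans
    (congrArg (⟪f 0, g 0⟫_ℂ + ·) (lp.inner_eq_tsum (bshift k f) (bshift k g)).symm))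

theorem L2plus.clm_ext {k : ℕ} {H : Type*} [NormedAddCommGroup H] [NormedSpace ℂ H]
    {T T' : L2plus k →L[ℂ] H} (h : ∀ j u, T (lp.single 2 j u) = T' (lp.single 2 j u)) : T = T' := by
  ext1 x
  have hx := lp.hasSum_single (E := fun _ : ℕ => EuclideanSpace ℂ (Fin k)) (p := 2) (by norm_num) x
  have h1 := hx.mapL T
  simp only [h] at h1
  exact h1.unique (hx.mapL T')

theorem adjoint_bshift_single {k : ℕ} (j : ℕ) (u : EuclideanSpace ℂ (Fin k)) :
    ContinuousLinearMap.adjoint (bshift k) (lp.single 2 j u) = lp.single 2 (j + 1) u := by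
  refine ext_inner_right ℂ fun g => ?_
  rw [ContinuousLinearMap.adjoint_inner_left, L2plus.inner_single_left,
    L2plus.inner_single_left, bshift_apply]

theorem bshift_single_succ {k : ℕ} (j : ℕ) (u : EuclideanSpace ℂ (Fin k)) :
    bshift k (lp.single 2 (j + 1) u) = lp.single 2 j u := by
  ext1
  funext i
  rw [bshift_apply]
  by_cases h : i = j
  · subst h; simp
  · simp [lp.single_apply, h]

theorem bshift_comp_adjoint (k : ℕ) :
    bshift k ∘L ContinuousLinearMap.adjoint (bshift k) = ContinuousLinearMap.id ℂ _ := by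
  refine L2plus.clm_ext fun j u => ?_
  rw [ContinuousLinearMap.comp_apply, adjoint_bshift_single, bshift_single_succ]
  rfl

theorem embZero_comp_adjoint (k : ℕ) :
    embZero k ∘L ContinuousLinearMap.adjoint (embZero k) +
      ContinuousLinearMap.adjoint (bshift k) ∘L bshift k = ContinuousLinearMap.id ℂ _ := by
  ext1 f
  refine ext_inner_left ℂ fun g => ?_
  simp only [add_apply, ContinuousLinearMap.comp_apply, inner_add_right,
    ContinuousLinearMap.adjoint_inner_right, ContinuousLinearMap.id_apply]
  rw [L2plus.inner_eq_add g f, ← ContinuousLinearMap.adjoint_inner_left, adjoint_embZero_apply,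
    adjoint_embZero_apply]

/-! ### Block Toeplitz operators -/

theorem HasToeplitzMatrix.toeplitz_eq {k l : ℕ} {Ω : RatMat k l} {T : L2plus l →L[ℂ] L2plus k}
    (h : HasToeplitzMatrix Ω T) : toeplitz Ω = T := by
  have h' : ∃ T, HasToeplitzMatrix Ω T := ⟨T, h⟩
  rw [toeplitz, dif_pos h']
  exact h'.choose_spec.unique h

/-- An analytic Toeplitz operator commutes with the forward shift, the adjoint of `bshift`. -/
theorem IsStableRational.toeplitz_comp_adjoint_bshift {k l : ℕ} {Ω : RatMat k l}
    (hΩ : IsStableRational Ω) :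
    toeplitz Ω ∘L ContinuousLinearMap.adjoint (bshift l) =
      ContinuousLinearMap.adjoint (bshift k) ∘L toeplitz Ω := by
  have hT := toeplitz_spec Ω hΩ.not_isPole_circle
  refine L2plus.clm_ext fun j u => ?_
  rw [ContinuousLinearMap.comp_apply, ContinuousLinearMap.comp_apply, adjoint_bshift_single]
  have h1 : toeplitz Ω (lp.single 2 (j + 1) u) 0 = 0 := by
    rw [hT, hΩ.fourierBlock_neg (by push_cast; omega)]
    simp
  have h2 : bshift k (toeplitz Ω (lp.single 2 (j + 1) u)) = toeplitz Ω (lp.single 2 j u) := by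
    ext1
    funext i
    rw [bshift_apply, hT, hT]
    congr 3
    push_cast
    ring
  have h3 := DFunLike.congr_fun (embZero_comp_adjoint k) (toeplitz Ω (lp.single 2 (j + 1) u))
  simp only [add_apply, ContinuousLinearMap.comp_apply,
    adjoint_embZero_apply, h1, h2, map_zero, zero_add, ContinuousLinearMap.id_apply] at h3
  exact h3.symm

theorem IsStableRational.adjoint_toeplitz_bshift {k l : ℕ} {Ω : RatMat k l}
    (hΩ : IsStableRational Ω) (f : L2plus k) :
    ContinuousLinearMap.adjoint (toeplitz Ω) (bshift k f) =
      bshift l (ContinuousLinearMap.adjoint (toeplitz Ω) f) := by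
  have h := congrArg ContinuousLinearMap.adjoint hΩ.toeplitz_comp_adjoint_bshift
  rw [ContinuousLinearMap.adjoint_comp, ContinuousLinearMap.adjoint_comp,
    ContinuousLinearMap.adjoint_adjoint, ContinuousLinearMap.adjoint_adjoint] at h
  exact (DFunLike.congr_fun h f).symm

/-- `T_{Ω₁^* Ω₂} = T_{Ω₁}^* T_{Ω₂}` for stable `Ω₁`, `Ω₂`. The entries of the right side are
sums over `s ≥ 0`; the terms with `s < 0` in Parseval's identity vanish by stability. -/
theorem hasToeplitzMatrix_paraConj_mul {k l p : ℕ} {Ω₁ : RatMat k l} {Ω₂ : RatMat k p}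
    (h₁ : IsStableRational Ω₁) (h₂ : IsStableRational Ω₂) :
    HasToeplitzMatrix (paraConj Ω₁ * Ω₂)
      (ContinuousLinearMap.adjoint (toeplitz Ω₁) ∘L toeplitz Ω₂) := by
  intro i j u
  have hT₁ := toeplitz_spec Ω₁ h₁.not_isPole_circle
  have hT₂ := toeplitz_spec Ω₂ h₂.not_isPole_circle
  refine ext_inner_left ℂ fun v => ?_
  rw [← L2plus.inner_single_left, ContinuousLinearMap.comp_apply,
    ContinuousLinearMap.adjoint_inner_right, lp.inner_eq_tsum]
  have h := hasSum_fourierBlock_paraConj_mul h₁ h₂ i j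
  let φ : Matrix (Fin l) (Fin p) ℂ →ₗ[ℂ] ℂ :=
    { toFun := fun M => ⟪v, Matrix.toEuclideanLin M u⟫_ℂ
      map_add' := fun M N => by rw [map_add, LinearMap.add_apply, inner_add_right]
      map_smul' := fun c M => by
        rw [map_smul, LinearMap.smul_apply, inner_smul_right]; rfl }
  have h3 : HasSum (fun s : ℤ => φ ((fourierBlock Ω₁ (s - i))ᴴ * fourierBlock Ω₂ (s - j)))
      (φ (fourierBlock (paraConj Ω₁ * Ω₂) (i - j))) :=
    h.map φ.toAddMonoidHom φ.continuous_of_finiteDimensional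
  rw [← (Nat.cast_injective (R := ℤ)).hasSum_iff] at h3
  · refine Eq.trans (tsum_congr fun s => ?_) h3.tsum_eq
    rw [hT₁, hT₂, inner_toEuclideanLin_left, ← toEuclideanLin_mul_apply]
    rfl
  · intro s hs
    have : s < 0 := by
      by_contra h0
      exact hs ⟨s.toNat, by simp; omega⟩
    rw [h₁.fourierBlock_neg (by omega)]
    simp

theorem toeplitz_paraConj_mul {k l p : ℕ} {Ω₁ : RatMat k l} {Ω₂ : RatMat k p}
    (h₁ : IsStableRational Ω₁) (h₂ : IsStableRational Ω₂) :
    toeplitz (paraConj Ω₁ * Ω₂) = ContinuousLinearMap.adjoint (toeplitz Ω₁) ∘L toeplitz Ω₂ :=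
  (hasToeplitzMatrix_paraConj_mul h₁ h₂).toeplitz_eq

theorem not_isPole_one_circle {k : ℕ} : ∀ w : ℂ, ‖w‖ = 1 → ¬ IsPole (1 : RatMat k k) w :=
  fun w _ => (evalMat_one k w).1

theorem fourierBlock_one (k : ℕ) (s : ℤ) :
    fourierBlock (1 : RatMat k k) s = if s = 0 then 1 else 0 := by
  ext a b
  have h : (fun t : UnitAddCircle => evalMat (1 : RatMat k k) (t.toCircle : ℂ) a b) =
      ((1 : Matrix (Fin k) (Fin k) ℂ) a b) • ⇑(fourier (T := (1 : ℝ)) 0) := by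
    funext t
    rw [(evalMat_one k _).2]
    simp
  rw [fourierBlock_apply, h, fourierCoeff.const_smul, fourierCoeff_fourier, Pi.single_apply]
  by_cases hs : s = 0 <;> simp [hs]

theorem IsTwoSidedInner.adjoint_toeplitz_comp {r : ℕ} {Θ : RatMat r r} (h : IsTwoSidedInner Θ) :
    ContinuousLinearMap.adjoint (toeplitz Θ) ∘L toeplitz Θ = ContinuousLinearMap.id ℂ _ := by
  have h1 : paraConj Θ * Θ = 1 := by
    refine RatMat.eq_of_evalMat_circle_eq (not_isPole_paraConj_mul h.stable h.stable)
      not_isPole_one_circle fun w hw => ?_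
    have hp := evalMat_paraConj hw (h.stable w hw.le)
    rw [(evalMat_mul hp.1 (h.stable w hw.le)).2, hp.2, (evalMat_one r w).2]
    exact (Matrix.mem_unitaryGroup_iff').1 (h.unitary w hw)
  have h2 := hasToeplitzMatrix_paraConj_mul h.stable h.stable
  rw [h1] at h2
  refine h2.unique fun i j u => ?_
  rw [fourierBlock_one]
  by_cases hij : i = j
  · subst hij
    simp [Matrix.toEuclideanLin]
  · simp [lp.single_apply, hij, sub_eq_zero]

theorem toeplitz_embZero_apply {k l : ℕ} {Ω : RatMat k l}
    (hΩ : ∀ w : ℂ, ‖w‖ = 1 → ¬ IsPole Ω w) (u : EuclideanSpace ℂ (Fin l)) (i : ℕ) :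
    toeplitz Ω (embZero l u) i = Matrix.toEuclideanLin (fourierBlock Ω i) u := by
  rw [embZero_apply, toeplitz_spec Ω hΩ]
  simp

theorem injective_adjoint_of_denseRange {E F : Type*} [NormedAddCommGroup E]
    [InnerProductSpace ℂ E] [CompleteSpace E] [NormedAddCommGroup F] [InnerProductSpace ℂ F]
    [CompleteSpace F] {T : E →L[ℂ] F} (hT : DenseRange T) :
    Function.Injective (ContinuousLinearMap.adjoint T) := by
  refine (injective_iff_map_eq_zero _).2 fun f hf => ?_
  refine hT.eq_zero_of_inner_left ℂ fun g => ?_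
  rw [← ContinuousLinearMap.adjoint_inner_left, hf, inner_zero_left]

/-! ### Observability operators and realizations -/

theorem obsOp_apply {k n : ℕ} (C : Matrix (Fin k) (Fin n) ℂ) {A : Matrix (Fin n) (Fin n) ℂ}
    (hA : IsStableMat A) (x : EuclideanSpace ℂ (Fin n)) (ν : ℕ) :
    obsOp C A hA x ν = Matrix.toEuclideanLin (C * A ^ ν) x := rfl

theorem bshift_obsOp {k n : ℕ} (C : Matrix (Fin k) (Fin n) ℂ) {A : Matrix (Fin n) (Fin n) ℂ}
    (hA : IsStableMat A) (x : EuclideanSpace ℂ (Fin n)) :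
    bshift k (obsOp C A hA x) = obsOp C A hA (Matrix.toEuclideanLin A x) := by
  ext1
  funext ν
  rw [bshift_apply, obsOp_apply, obsOp_apply, pow_succ, ← Matrix.mul_assoc,
    toEuclideanLin_mul_apply]

/-- A function with vanishing Fourier coefficients of negative index whose further coefficients
are those of a realization is given by that realization. -/
theorem eq_realization_of_bshift_toeplitz {k l n : ℕ} {A : Matrix (Fin n) (Fin n) ℂ}
    (hA : IsStableMat A) {Ω : RatMat k l} (hΩ : ∀ w : ℂ, ‖w‖ = 1 → ¬ IsPole Ω w)
    (hneg : ∀ s < 0, fourierBlock Ω s = 0) (C : Matrix (Fin k) (Fin n) ℂ)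
    (B : Matrix (Fin n) (Fin l) ℂ)
    (h : ∀ u, bshift k (toeplitz Ω (embZero l u)) = obsOp C A hA (Matrix.toEuclideanLin B u)) :
    Ω = realization (fourierBlock Ω 0) C A B := by
  have hr := isStableRational_realization hA (fourierBlock Ω 0) C B
  refine RatMat.eq_of_fourierBlock_eq hΩ hr.not_isPole_circle fun s => ?_
  rcases lt_trichotomy s 0 with hs | rfl | hs
  · rw [hneg s hs, hr.fourierBlock_neg hs]
  · rw [hr.fourierBlock_zero, (evalMat_realization hA _ C B (by simp)).2]
    simp
  · obtain ⟨ν, rfl⟩ : ∃ ν : ℕ, s = ν + 1 := ⟨(s - 1).toNat, by omega⟩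
    rw [fourierBlock_realization hA]
    refine Matrix.toEuclideanLin.injective (LinearMap.ext fun u => ?_)
    have h1 := congrArg (fun f : L2plus k => f ν) (h u)
    simp only [bshift_apply, obsOp_apply] at h1
    rw [toeplitz_embZero_apply hΩ, ← toEuclideanLin_mul_apply] at h1
    exact_mod_cast h1

theorem bshift_toeplitz_realization {k l n : ℕ} {A : Matrix (Fin n) (Fin n) ℂ}
    (hA : IsStableMat A) (D : Matrix (Fin k) (Fin l) ℂ) (C : Matrix (Fin k) (Fin n) ℂ)
    (B : Matrix (Fin n) (Fin l) ℂ) (u : EuclideanSpace ℂ (Fin l)) :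
    bshift k (toeplitz (realization D C A B) (embZero l u)) =
      obsOp C A hA (Matrix.toEuclideanLin B u) := by
  ext1
  funext ν
  rw [bshift_apply, obsOp_apply, toeplitz_embZero_apply
    (isStableRational_realization hA D C B).not_isPole_circle, ← toEuclideanLin_mul_apply,
    ← fourierBlock_realization hA D C B ν]
  push_cast
  rfl

theorem fourierBlock_realization_zero {k l n : ℕ} {A : Matrix (Fin n) (Fin n) ℂ}
    (hA : IsStableMat A) (D : Matrix (Fin k) (Fin l) ℂ) (C : Matrix (Fin k) (Fin n) ℂ)
    (B : Matrix (Fin n) (Fin l) ℂ) : fourierBlock (realization D C A B) 0 = D := by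
  rw [(isStableRational_realization hA D C B).fourierBlock_zero,
    (evalMat_realization hA D C B (by simp)).2]
  simp

/-! ### Gramians -/

theorem adjoint_obsOp_comp_obsOp {k n : ℕ} (C : Matrix (Fin k) (Fin n) ℂ)
    {A : Matrix (Fin n) (Fin n) ℂ} (hA : IsStableMat A) :
    ContinuousLinearMap.adjoint (obsOp C A hA) ∘L obsOp C A hA =
      Matrix.toEuclideanCLM (𝕜 := ℂ) (obsGramian C A) := by
  ext1 x
  refine ext_inner_left ℂ fun y => ?_
  rw [ContinuousLinearMap.comp_apply, ContinuousLinearMap.adjoint_inner_right, lp.inner_eq_tsum]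
  let φ : Matrix (Fin n) (Fin n) ℂ →ₗ[ℂ] ℂ :=
    { toFun := fun M => ⟪y, Matrix.toEuclideanLin M x⟫_ℂ
      map_add' := fun M N => by rw [map_add, LinearMap.add_apply, inner_add_right]
      map_smul' := fun c M => by
        rw [map_smul, LinearMap.smul_apply, inner_smul_right]; rfl }
  have h : HasSum (fun ν : ℕ => φ (Aᴴ ^ ν * Cᴴ * C * A ^ ν)) (φ (obsGramian C A)) :=
    (hA.summable_obs C).hasSum.map φ.toAddMonoidHom φ.continuous_of_finiteDimensional
  refine Eq.trans (tsum_congr fun ν => ?_) h.tsum_eq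
  rw [obsOp_apply, obsOp_apply, inner_toEuclideanLin_left, ← toEuclideanLin_mul_apply,
    Matrix.conjTranspose_mul, Matrix.conjTranspose_pow]
  simp only [φ, LinearMap.coe_mk, AddHom.coe_mk, Matrix.mul_assoc]

section
open scoped Matrix.Norms.L2Operator

/-- The Stein equation determines the controllability Gramian. -/
theorem contrGramian_eq_of_stein {k n : ℕ} {A : Matrix (Fin n) (Fin n) ℂ} (hA : IsStableMat A)
    {B : Matrix (Fin n) (Fin k) ℂ} {N : Matrix (Fin n) (Fin n) ℂ}
    (hN : N = A * N * Aᴴ + B * Bᴴ) : contrGramian A B = N := by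
  have hsum := (hA.summable_contr B).hasSum.tendsto_sum_nat
  -- the partial sums telescope
  have hpart : ∀ K : ℕ, ∑ ν ∈ Finset.range K, A ^ ν * B * Bᴴ * Aᴴ ^ ν =
      N - A ^ K * N * Aᴴ ^ K := by
    intro K
    induction K with
    | zero => simp
    | succ K ih =>
      have h1 : A ^ K * N * Aᴴ ^ K =
          A ^ (K + 1) * N * Aᴴ ^ (K + 1) + A ^ K * B * Bᴴ * Aᴴ ^ K := by
        conv_lhs => rw [hN]
        rw [pow_succ A, pow_succ' Aᴴ]
        simp only [Matrix.mul_add, Matrix.add_mul, Matrix.mul_assoc]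
      rw [Finset.sum_range_succ, ih, h1]
      abel
  have h0 : Filter.Tendsto (fun K : ℕ => A ^ K) Filter.atTop (nhds 0) :=
    tendsto_zero_iff_norm_tendsto_zero.2 hA.summable_norm_pow.tendsto_atTop_zero
  have h0' : Filter.Tendsto (fun K : ℕ => Aᴴ ^ K) Filter.atTop (nhds 0) :=
    tendsto_zero_iff_norm_tendsto_zero.2 hA.conjTranspose.summable_norm_pow.tendsto_atTop_zero
  have h2 : Filter.Tendsto (fun K : ℕ => N - A ^ K * N * Aᴴ ^ K) Filter.atTop (nhds N) := by
    have h3 := ((h0.mul_const N).mul h0').const_sub N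
    simpa using h3
  simp only [hpart] at hsum
  exact tendsto_nhds_unique hsum h2

end


/-! ### Injective operators from a finite dimensional space -/

section
variable {X H : Type*} [NormedAddCommGroup X] [InnerProductSpace ℂ X] [FiniteDimensional ℂ X]
  [CompleteSpace X] [NormedAddCommGroup H] [InnerProductSpace ℂ H] [CompleteSpace H]

theorem isUnit_adjoint_comp_self {L : X →L[ℂ] H} (hL : Function.Injective L) :
    IsUnit (ContinuousLinearMap.adjoint L ∘L L) := by
  have hinj : Function.Injective (ContinuousLinearMap.adjoint L ∘L L) := by
    refine (injective_iff_map_eq_zero _).2 fun x hx => ?_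
    have h : ⟪L x, L x⟫_ℂ = 0 := by
      rw [← ContinuousLinearMap.adjoint_inner_right, ← ContinuousLinearMap.comp_apply, hx,
        inner_zero_right]
    exact (injective_iff_map_eq_zero L).1 hL x (inner_self_eq_zero.1 h)
  rw [ContinuousLinearMap.isUnit_iff_bijective]
  exact ⟨hinj, (LinearMap.injective_iff_surjective (K := ℂ)
    (f := (ContinuousLinearMap.adjoint L ∘L L : X →ₗ[ℂ] X))).1 hinj⟩

theorem inverse_adjoint_comp_self_apply {L : X →L[ℂ] H} (hL : Function.Injective L) (x : X) :
    Ring.inverse (ContinuousLinearMap.adjoint L ∘L L) (ContinuousLinearMap.adjoint L (L x)) = x :=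
  DFunLike.congr_fun (Ring.inverse_mul_cancel _ (isUnit_adjoint_comp_self hL)) x

theorem adjoint_comp_self_inverse_apply {L : X →L[ℂ] H} (hL : Function.Injective L) (x : X) :
    ContinuousLinearMap.adjoint L (L (Ring.inverse (ContinuousLinearMap.adjoint L ∘L L) x)) = x :=
  DFunLike.congr_fun (Ring.mul_inverse_cancel _ (isUnit_adjoint_comp_self hL)) x

/-- If `T` is an isometry and `Ker T^* = Im L`, then `T T^*` and `L (L^* L)⁻¹ L^*` are the
complementary orthogonal projections onto the range of `T` and of `L`. -/
theorem isometry_adjoint_add_projection {L : X →L[ℂ] H} (hL : Function.Injective L) {T : H →L[ℂ] H}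
    (hT : ContinuousLinearMap.adjoint T ∘L T = ContinuousLinearMap.id ℂ H)
    (hker : ∀ f, ContinuousLinearMap.adjoint T f = 0 ↔ ∃ x, L x = f) (f : H) :
    T (ContinuousLinearMap.adjoint T f) + L (Ring.inverse (ContinuousLinearMap.adjoint L ∘L L)
      (ContinuousLinearMap.adjoint L f)) = f := by
  have hT' : ∀ g, ContinuousLinearMap.adjoint T (T g) = g := DFunLike.congr_fun hT
  obtain ⟨x, hx⟩ := (hker (f - T (ContinuousLinearMap.adjoint T f))).1 (by
    rw [map_sub, hT', sub_self])
  have hLT : ∀ g, ContinuousLinearMap.adjoint L (T g) = 0 := fun g => by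
    refine ext_inner_right ℂ fun y => ?_
    rw [ContinuousLinearMap.adjoint_inner_left, ← ContinuousLinearMap.adjoint_inner_right,
      (hker _).2 ⟨y, rfl⟩, inner_zero_right, inner_zero_left]
  have h1 : ContinuousLinearMap.adjoint L f = ContinuousLinearMap.adjoint L (L x) := by
    rw [hx, map_sub, hLT, sub_zero]
  rw [h1, inverse_adjoint_comp_self_apply hL, hx]
  abel

end

section
variable {E V : Type*} [NormedAddCommGroup E] [InnerProductSpace ℂ E] [CompleteSpace E]
  [NormedAddCommGroup V] [InnerProductSpace ℂ V] [CompleteSpace V]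

theorem adjoint_codRestrict_orthogonalProjectionOnto (X : Submodule ℂ V) [CompleteSpace X]
    {β : E →L[ℂ] V} {B' : E →L[ℂ] X} (h : ∀ u, (B' u : V) = β u) (x : V) :
    ContinuousLinearMap.adjoint (F := X) B' (X.orthogonalProjectionOnto x) =
      ContinuousLinearMap.adjoint β x := by
  refine ext_inner_right ℂ fun u => ?_
  rw [ContinuousLinearMap.adjoint_inner_left, ContinuousLinearMap.adjoint_inner_left, ← h]
  exact Submodule.inner_orthogonalProjectionOnto_eq_of_mem_right (B' u) x

theorem adjoint_restrict_orthogonalProjectionOnto (X : Submodule ℂ V) [CompleteSpace X]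
    {α : V →L[ℂ] V} {A' : X →L[ℂ] X} (h : ∀ y, (A' y : V) = α y) (x : V) :
    ContinuousLinearMap.adjoint (E := X) (F := X) A' (X.orthogonalProjectionOnto x) =
      X.orthogonalProjectionOnto (ContinuousLinearMap.adjoint α x) := by
  refine ext_inner_right ℂ fun y => ?_
  rw [ContinuousLinearMap.adjoint_inner_left]
  refine (Submodule.inner_orthogonalProjectionOnto_eq_of_mem_right (A' y) x).trans ?_
  rw [h, ← ContinuousLinearMap.adjoint_inner_left]
  exact (Submodule.inner_orthogonalProjectionOnto_eq_of_mem_right y _).symm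

end

/-- The Stein equation `G = A' G A'^* + B' B'^*` for `G = (L^* L)⁻¹`, where `Im L = Ker T_Θ^*`,
the backward shift `Z` acts on this space as `A'`, and `Z T_Θ (u, 0, 0, …) = L B' u`. It is obtained
by compressing `P - Z P Z^* = (Z T_Θ E)(Z T_Θ E)^*`, for `P = 1 - T_Θ T_Θ^* = L G L^*` and the
embedding `E` of the first coordinate, with the left inverse `G L^*` of `L`. -/
theorem stein_of_shift_invariant {r : ℕ} {X : Type*} [NormedAddCommGroup X] [InnerProductSpace ℂ X]
    [FiniteDimensional ℂ X] [CompleteSpace X] {Θ : RatMat r r} (hΘ : IsTwoSidedInner Θ)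
    {L : X →L[ℂ] L2plus r} (hL : Function.Injective L)
    (hker : ∀ f, ContinuousLinearMap.adjoint (toeplitz Θ) f = 0 ↔ ∃ x, L x = f)
    {A' : X →L[ℂ] X} (hA' : bshift r ∘L L = L ∘L A')
    {B' : EuclideanSpace ℂ (Fin r) →L[ℂ] X}
    (hB' : bshift r ∘L toeplitz Θ ∘L embZero r = L ∘L B') (x : X) :
    Ring.inverse (ContinuousLinearMap.adjoint L ∘L L) x =
      A' (Ring.inverse (ContinuousLinearMap.adjoint L ∘L L)
        (ContinuousLinearMap.adjoint A' x)) + B' (ContinuousLinearMap.adjoint B' x) := by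
  have hproj := isometry_adjoint_add_projection hL hΘ.adjoint_toeplitz_comp hker
  set T := toeplitz Θ
  set Z := bshift r
  set G := Ring.inverse (ContinuousLinearMap.adjoint L ∘L L)
  have hZ : ∀ f, Z (ContinuousLinearMap.adjoint Z f) = f :=
    DFunLike.congr_fun (bshift_comp_adjoint r)
  have hTZ : ∀ f, T (ContinuousLinearMap.adjoint Z f) = ContinuousLinearMap.adjoint Z (T f) :=
    DFunLike.congr_fun hΘ.stable.toeplitz_comp_adjoint_bshift
  have hTZ' : ∀ f, ContinuousLinearMap.adjoint T (Z f) = Z (ContinuousLinearMap.adjoint T f) :=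
    hΘ.stable.adjoint_toeplitz_bshift
  have hE : ∀ f, embZero r (ContinuousLinearMap.adjoint (embZero r) f) =
      f - ContinuousLinearMap.adjoint Z (Z f) := fun f =>
    eq_sub_of_add_eq (DFunLike.congr_fun (embZero_comp_adjoint r) f)
  have hZL : ∀ y, Z (L y) = L (A' y) := DFunLike.congr_fun hA'
  have hZT : ∀ u, Z (T (embZero r u)) = L (B' u) := DFunLike.congr_fun hB'
  have hA'' : ∀ f, ContinuousLinearMap.adjoint A' (ContinuousLinearMap.adjoint L f) =
      ContinuousLinearMap.adjoint L (ContinuousLinearMap.adjoint Z f) := fun f => by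
    have h := congrArg ContinuousLinearMap.adjoint hA'
    rw [ContinuousLinearMap.adjoint_comp, ContinuousLinearMap.adjoint_comp] at h
    exact (DFunLike.congr_fun h f).symm
  have hB'' : ∀ f, ContinuousLinearMap.adjoint B' (ContinuousLinearMap.adjoint L f) =
      ContinuousLinearMap.adjoint (embZero r) (ContinuousLinearMap.adjoint T
        (ContinuousLinearMap.adjoint Z f)) := fun f => by
    have h := congrArg ContinuousLinearMap.adjoint hB'
    rw [ContinuousLinearMap.adjoint_comp, ContinuousLinearMap.adjoint_comp,
      ContinuousLinearMap.adjoint_comp] at h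
    exact (DFunLike.congr_fun h f).symm
  have key : ∀ f, G (ContinuousLinearMap.adjoint L f) =
      A' (G (ContinuousLinearMap.adjoint A' (ContinuousLinearMap.adjoint L f))) +
        B' (ContinuousLinearMap.adjoint B' (ContinuousLinearMap.adjoint L f)) := fun f => by
    refine hL ?_
    rw [map_add, hA'', hB'', ← hZL, ← hZT, hE, eq_sub_of_add_eq' (hproj f),
      eq_sub_of_add_eq' (hproj (ContinuousLinearMap.adjoint Z f)), map_sub, map_sub, map_sub, hZ,
      hTZ, hZ, ← hTZ', hZ]
    abel
  have h := key (L (G x))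
  rwa [adjoint_comp_self_inverse_apply hL] at h

/-! ### The state space of the outer factor -/

section
variable {m n r : ℕ} {A : Matrix (Fin n) (Fin n) ℂ} {C : Matrix (Fin m) (Fin n) ℂ}
  {hA : IsStableMat A} {Φ : RatMat r m} {CΦ : Matrix (Fin r) (Fin n) ℂ}

theorem mem_spaceX {x : EuclideanSpace ℂ (Fin n)} :
    x ∈ spaceX C A hA Φ ↔
      ∃ f, ContinuousLinearMap.adjoint (toeplitz Φ) f = obsOp C A hA x := Iff.rfl

theorem mem_spaceM {f : L2plus r} :
    f ∈ spaceM C A hA Φ ↔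
      ∃ x, obsOp C A hA x = ContinuousLinearMap.adjoint (toeplitz Φ) f := Iff.rfl

theorem toEuclideanLin_mem_spaceX (hs : IsStableRational Φ) {x : EuclideanSpace ℂ (Fin n)}
    (hx : x ∈ spaceX C A hA Φ) : Matrix.toEuclideanLin A x ∈ spaceX C A hA Φ := by
  obtain ⟨f, hf⟩ := mem_spaceX.1 hx
  refine mem_spaceX.2 ⟨bshift r f, ?_⟩
  rw [hs.adjoint_toeplitz_bshift, hf, bshift_obsOp]

/-- With a linear left inverse `g` of `T_Φ^*`, the first entry of the sequence `g (W_obs x)` gives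
the output matrix: `𝒳_Φ` is invariant under `A`, and `g W_obs` intertwines `A` with the
backward shift there. -/
theorem exists_isStateOutput (hs : IsStableRational Φ)
    (hinj : Function.Injective (ContinuousLinearMap.adjoint (toeplitz Φ))) :
    ∃ CΦ : Matrix (Fin r) (Fin n) ℂ, IsStateOutput C A hA Φ CΦ := by
  obtain ⟨g, hg⟩ := LinearMap.exists_leftInverse_of_injective
    (ContinuousLinearMap.adjoint (toeplitz Φ) : L2plus r →ₗ[ℂ] L2plus m)
    (LinearMap.ker_eq_bot.2 hinj)
  have hg' : ∀ f, g (ContinuousLinearMap.adjoint (toeplitz Φ) f) = f := LinearMap.congr_fun hg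
  let c : EuclideanSpace ℂ (Fin n) →ₗ[ℂ] EuclideanSpace ℂ (Fin r) :=
    (ContinuousLinearMap.adjoint (embZero r) : L2plus r →ₗ[ℂ] EuclideanSpace ℂ (Fin r)) ∘ₗ g ∘ₗ
      (obsOp C A hA : EuclideanSpace ℂ (Fin n) →ₗ[ℂ] L2plus m)
  refine ⟨Matrix.toEuclideanLin.symm c, fun x hx => ?_⟩
  obtain ⟨f, hf⟩ := mem_spaceX.1 hx
  suffices h : ∀ (ν : ℕ) (x : EuclideanSpace ℂ (Fin n)) (f : L2plus r),
      ContinuousLinearMap.adjoint (toeplitz Φ) f = obsOp C A hA x →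
      obsOp (Matrix.toEuclideanLin.symm c) A hA x ν = f ν by
    have h1 : obsOp (Matrix.toEuclideanLin.symm c) A hA x = f := by
      ext1
      funext ν
      exact h ν x f hf
    rw [h1, hf]
  intro ν
  induction ν with
  | zero =>
    intro x f hf
    rw [obsOp_apply, pow_zero, Matrix.mul_one, LinearEquiv.apply_symm_apply]
    change ContinuousLinearMap.adjoint (embZero r) (g (obsOp C A hA x)) = _
    rw [← hf, hg', adjoint_embZero_apply]
  | succ ν ih =>
    intro x f hf
    rw [← bshift_apply, bshift_obsOp, ih _ (bshift r f), bshift_apply]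
    rw [hs.adjoint_toeplitz_bshift, hf, bshift_obsOp]

/-- `ℳ_Φ` is the image of `𝒳_Φ` under the observability operator of `{C_Φ, A}`. -/
theorem mem_spaceM_iff (hinj : Function.Injective (ContinuousLinearMap.adjoint (toeplitz Φ)))
    (hC : IsStateOutput C A hA Φ CΦ) (f : L2plus r) :
    f ∈ spaceM C A hA Φ ↔ ∃ x : spaceX C A hA Φ, obsOp CΦ A hA x = f := by
  rw [mem_spaceM]
  constructor
  · rintro ⟨x, hx⟩
    have hxX : x ∈ spaceX C A hA Φ := mem_spaceX.2 ⟨f, hx.symm⟩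
    exact ⟨⟨x, hxX⟩, hinj ((hC x hxX).symm.trans hx)⟩
  · rintro ⟨x, rfl⟩
    exact ⟨x, hC x x.2⟩

theorem injective_obsOp_comp_subtypeL (hobs : IsObservable C A hA)
    (hC : IsStateOutput C A hA Φ CΦ) :
    Function.Injective (obsOp CΦ A hA ∘L (spaceX C A hA Φ).subtypeL) := by
  refine (injective_iff_map_eq_zero _).2 fun x hx => ?_
  have h1 : obsOp C A hA x = 0 := by
    rw [hC x x.2]
    exact (congrArg _ hx).trans (map_zero _)
  exact Subtype.ext ((injective_iff_map_eq_zero _).1 (LinearMap.ker_eq_bot.1 hobs) _ h1)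

theorem compression_eq (hA : IsStableMat A) (X : Submodule ℂ (EuclideanSpace ℂ (Fin n))) :
    compression X (obsGramian CΦ A) =
      ContinuousLinearMap.adjoint (E := X) (obsOp CΦ A hA ∘L X.subtypeL) ∘L
        (obsOp CΦ A hA ∘L X.subtypeL) := by
  rw [compression, ← adjoint_obsOp_comp_obsOp CΦ hA, ContinuousLinearMap.adjoint_comp,
    Submodule.adjoint_subtypeL]
  rfl

/-- The backward shift of the column `Φ v` lies in `ℳ_Φ`; it corresponds to the state `Γ v`. -/
theorem bshift_outer_column (hinj : Function.Injective (ContinuousLinearMap.adjoint (toeplitz Φ)))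
    (hs : IsStableRational Φ) (hC : IsStateOutput C A hA Φ CΦ)
    {Γ : Matrix (Fin n) (Fin m) ℂ} {R₀ : Matrix (Fin m) (Fin m) ℂ}
    (hR : spectralFunction A C Γ R₀ = paraConj Φ * Φ) (v : EuclideanSpace ℂ (Fin m)) :
    Matrix.toEuclideanLin Γ v ∈ spaceX C A hA Φ ∧
      bshift r (toeplitz Φ (embZero m v)) = obsOp CΦ A hA (Matrix.toEuclideanLin Γ v) := by
  have h1 : ContinuousLinearMap.adjoint (toeplitz Φ) (bshift r (toeplitz Φ (embZero m v))) =
      obsOp C A hA (Matrix.toEuclideanLin Γ v) := by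
    rw [hs.adjoint_toeplitz_bshift, ← ContinuousLinearMap.comp_apply (toeplitz Φ).adjoint,
      ← toeplitz_paraConj_mul hs hs, ← hR]
    ext1
    funext ν
    rw [bshift_apply, toeplitz_embZero_apply (hR ▸ not_isPole_paraConj_mul hs hs), obsOp_apply,
      ← toEuclideanLin_mul_apply, ← fourierBlock_spectralFunction hA C Γ R₀ ν]
    push_cast
    rfl
  have h2 := mem_spaceX.2 ⟨_, h1⟩
  exact ⟨h2, hinj (h1.trans (hC _ h2))⟩

/-! ### The inner function and the product `Φ^* Θ` -/

variable {Θ : RatMat r r}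

theorem adjoint_toeplitz_eq_zero_iff
    (hinj : Function.Injective (ContinuousLinearMap.adjoint (toeplitz Φ)))
    (hC : IsStateOutput C A hA Φ CΦ) (hΘ : IsInnerDeterminedBy Θ (spaceM C A hA Φ))
    (f : L2plus r) : ContinuousLinearMap.adjoint (toeplitz Θ) f = 0 ↔
      ∃ x : spaceX C A hA Φ, obsOp CΦ A hA x = f := by
  rw [← mem_spaceM_iff hinj hC, ← hΘ.ker_eq]
  rfl

/-- The backward shift of the column `Θ u` lies in `Ker T_Θ^* = ℳ_Φ`, because `T_Θ` is an isometry
and `T_Θ^*` commutes with the backward shift. The corresponding state is `B_Θ u`. -/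
theorem exists_isThetaRealization
    (hinj : Function.Injective (ContinuousLinearMap.adjoint (toeplitz Φ)))
    (hobs : IsObservable C A hA) (hC : IsStateOutput C A hA Φ CΦ)
    (hΘ : IsInnerDeterminedBy Θ (spaceM C A hA Φ)) :
    ∃ (BΘ : Matrix (Fin n) (Fin r) ℂ) (DΘ : Matrix (Fin r) (Fin r) ℂ),
      IsThetaRealization (spaceX C A hA Φ) A CΦ Θ BΘ DΘ := by
  set X := spaceX C A hA Φ
  obtain ⟨g, hg⟩ := LinearMap.exists_leftInverse_of_injective
    (obsOp CΦ A hA ∘L X.subtypeL : X →ₗ[ℂ] L2plus r)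
    (LinearMap.ker_eq_bot.2 (injective_obsOp_comp_subtypeL hobs hC))
  let b : EuclideanSpace ℂ (Fin r) →ₗ[ℂ] EuclideanSpace ℂ (Fin n) :=
    X.subtype ∘ₗ g ∘ₗ (bshift r ∘L toeplitz Θ ∘L embZero r :
      EuclideanSpace ℂ (Fin r) →ₗ[ℂ] L2plus r)
  have hb : ∀ u, bshift r (toeplitz Θ (embZero r u)) = obsOp CΦ A hA (b u) := fun u => by
    have h1 : bshift r (toeplitz Θ (embZero r u)) ∈ spaceM C A hA Φ := by
      rw [← hΘ.ker_eq, LinearMap.mem_ker]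
      change ContinuousLinearMap.adjoint (toeplitz Θ) _ = 0
      rw [hΘ.inner.stable.adjoint_toeplitz_bshift,
        ← ContinuousLinearMap.comp_apply (toeplitz Θ).adjoint,
        hΘ.inner.adjoint_toeplitz_comp]
      ext1
      funext i
      rw [bshift_apply, ContinuousLinearMap.id_apply, embZero_apply]
      simp [lp.single_apply]
    obtain ⟨x, hx⟩ := (mem_spaceM_iff hinj hC _).1 h1
    have h2 : b u = x := by
      change ((g (bshift r (toeplitz Θ (embZero r u))) : X) : EuclideanSpace ℂ (Fin n)) = x
      rw [← hx]
      exact congrArg Subtype.val (LinearMap.congr_fun hg x)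
    rw [h2, hx]
  refine ⟨Matrix.toEuclideanLin.symm b, fourierBlock Θ 0, ?_, ?_⟩
  · rw [LinearEquiv.apply_symm_apply]
    rintro _ ⟨u, rfl⟩
    exact (g _).2
  · refine eq_realization_of_bshift_toeplitz hA hΘ.inner.stable.not_isPole_circle
      (fun s hs => hΘ.inner.stable.fourierBlock_neg hs) _ _ fun u => ?_
    rw [LinearEquiv.apply_symm_apply, hb]

theorem IsThetaRealization.bshift_toeplitz {X : Submodule ℂ (EuclideanSpace ℂ (Fin n))}
    {BΘ : Matrix (Fin n) (Fin r) ℂ} {DΘ : Matrix (Fin r) (Fin r) ℂ}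
    (h : IsThetaRealization X A CΦ Θ BΘ DΘ) (hA : IsStableMat A) (u : EuclideanSpace ℂ (Fin r)) :
    bshift r (toeplitz Θ (embZero r u)) = obsOp CΦ A hA (Matrix.toEuclideanLin BΘ u) := by
  rw [h.eq, bshift_toeplitz_realization hA]

/-- `F = Φ^* Θ` has the Fourier coefficients of the asserted realization: those of negative index
vanish because the backward shift of `Φ v` lies in `Ker T_Θ^*`, those of positive index come from
`Z T_F = T_Φ^* Z T_Θ`, and `⟪v, F₀ u⟫ = ⟪Φ v, Θ u⟫` is split into the contribution of the first
entries and that of the shifted sequences, which equals `⟪Γ v, Q_Φ B_Θ u⟫`. -/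
theorem paraConj_mul_eq_realization
    (hinj : Function.Injective (ContinuousLinearMap.adjoint (toeplitz Φ)))
    (hs : IsStableRational Φ) (hC : IsStateOutput C A hA Φ CΦ)
    {Γ : Matrix (Fin n) (Fin m) ℂ} {R₀ : Matrix (Fin m) (Fin m) ℂ}
    (hR : spectralFunction A C Γ R₀ = paraConj Φ * Φ)
    (hΘ : IsInnerDeterminedBy Θ (spaceM C A hA Φ))
    {BΘ : Matrix (Fin n) (Fin r) ℂ} {DΘ : Matrix (Fin r) (Fin r) ℂ}
    (hB : IsThetaRealization (spaceX C A hA Φ) A CΦ Θ BΘ DΘ) :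
    paraConj Φ * Θ =
      realization ((evalMat Φ 0)ᴴ * DΘ + Γᴴ * obsGramian CΦ A * BΘ) C A BΘ := by
  have hsΘ := hΘ.inner.stable
  have hF := not_isPole_paraConj_mul hs hsΘ
  have hT := toeplitz_paraConj_mul hs hsΘ
  have hTF := toeplitz_spec _ hF
  have hcol := bshift_outer_column hinj hs hC hR
  have hneg : ∀ s < 0, fourierBlock (paraConj Φ * Θ) s = 0 := by
    intro s hs0
    obtain ⟨k, rfl⟩ : ∃ k : ℕ, s = ((0 : ℕ) : ℤ) - ((k + 1 : ℕ) : ℤ) :=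
      ⟨(-s - 1).toNat, by omega⟩
    refine Matrix.toEuclideanLin.injective (LinearMap.ext fun u => ?_)
    rw [← hTF, map_zero, LinearMap.zero_apply]
    refine ext_inner_left ℂ fun v => ?_
    -- `T_Θ^*` annihilates the backward shift of `Φ v`, which lies in `ℳ_Φ`
    have h1 : ContinuousLinearMap.adjoint (toeplitz Θ)
        (bshift r (toeplitz Φ (embZero m v))) = 0 := by
      have : bshift r (toeplitz Φ (embZero m v)) ∈ spaceM C A hA Φ :=
        (mem_spaceM_iff hinj hC _).2 ⟨⟨_, (hcol v).1⟩, (hcol v).2.symm⟩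
      rwa [← hΘ.ker_eq, LinearMap.mem_ker] at this
    rw [← adjoint_embZero_apply, ContinuousLinearMap.adjoint_inner_right, hT,
      ContinuousLinearMap.comp_apply, ContinuousLinearMap.adjoint_inner_right,
      ← ContinuousLinearMap.adjoint_inner_left, ← adjoint_bshift_single,
      ContinuousLinearMap.adjoint_inner_right, ← hsΘ.adjoint_toeplitz_bshift, h1, inner_zero_left,
      inner_zero_right]
  -- `Z T_F = T_Φ^* Z T_Θ`, and `T_Φ^*` maps `W_{Φ,obs} B_Θ u` to `W_obs B_Θ u`
  have hreal := eq_realization_of_bshift_toeplitz hA hF hneg C BΘ fun u => by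
    rw [hT, ContinuousLinearMap.comp_apply, ← hs.adjoint_toeplitz_bshift,
      hB.bshift_toeplitz hA, ← hC _ (hB.range_le ⟨u, rfl⟩)]
  have hzero : fourierBlock (paraConj Φ * Θ) 0 =
      (evalMat Φ 0)ᴴ * DΘ + Γᴴ * obsGramian CΦ A * BΘ := by
    refine Matrix.toEuclideanLin.injective (LinearMap.ext fun u => ?_)
    refine ext_inner_left ℂ fun v => ?_
    have h0 := toeplitz_embZero_apply hF u 0
    rw [Nat.cast_zero] at h0
    have hΦ0 := toeplitz_embZero_apply hs.not_isPole_circle v 0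
    rw [Nat.cast_zero, hs.fourierBlock_zero] at hΦ0
    have hΘ0 := toeplitz_embZero_apply hsΘ.not_isPole_circle u 0
    have hD : fourierBlock Θ 0 = DΘ := by rw [hB.eq, fourierBlock_realization_zero hA]
    rw [Nat.cast_zero, hD] at hΘ0
    rw [← h0, ← adjoint_embZero_apply, ContinuousLinearMap.adjoint_inner_right, hT,
      ContinuousLinearMap.comp_apply, ContinuousLinearMap.adjoint_inner_right,
      L2plus.inner_eq_add, hΦ0, hΘ0, (hcol v).2, hB.bshift_toeplitz hA,
      ← ContinuousLinearMap.adjoint_inner_right, ← ContinuousLinearMap.comp_apply,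
      adjoint_obsOp_comp_obsOp, inner_toEuclideanLin_left, inner_toEuclideanLin_left,
      ← toEuclideanLin_mul_apply, map_add, LinearMap.add_apply, inner_add_right,
      Matrix.mul_assoc, toEuclideanLin_mul_apply Γᴴ, toEuclideanLin_mul_apply (obsGramian CΦ A)]
    rfl
  rwa [hzero] at hreal

/-- Both sides solve the same Stein equation `N = A N Aᴴ + B_Θ B_Θᴴ`. -/
theorem deltaMap_eq_contrGramian
    (hinj : Function.Injective (ContinuousLinearMap.adjoint (toeplitz Φ)))
    (hs : IsStableRational Φ) (hobs : IsObservable C A hA) (hC : IsStateOutput C A hA Φ CΦ)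
    (hΘ : IsInnerDeterminedBy Θ (spaceM C A hA Φ))
    {BΘ : Matrix (Fin n) (Fin r) ℂ} {DΘ : Matrix (Fin r) (Fin r) ℂ}
    (hB : IsThetaRealization (spaceX C A hA Φ) A CΦ Θ BΘ DΘ) :
    deltaMap (spaceX C A hA Φ) (obsGramian CΦ A) =
      Matrix.toEuclideanCLM (𝕜 := ℂ) (contrGramian A BΘ) := by
  set X := spaceX C A hA Φ
  set L := obsOp CΦ A hA ∘L X.subtypeL
  have hL : Function.Injective L := injective_obsOp_comp_subtypeL hobs hC
  have hker : ∀ f, ContinuousLinearMap.adjoint (toeplitz Θ) f = 0 ↔ ∃ x : X, L x = f :=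
    adjoint_toeplitz_eq_zero_iff hinj hC hΘ
  let α : EuclideanSpace ℂ (Fin n) →L[ℂ] EuclideanSpace ℂ (Fin n) :=
    Matrix.toEuclideanCLM (𝕜 := ℂ) A
  let β : EuclideanSpace ℂ (Fin r) →L[ℂ] EuclideanSpace ℂ (Fin n) :=
    (Matrix.toEuclideanLin BΘ).toContinuousLinearMap
  let A' : X →L[ℂ] X := (α ∘L X.subtypeL).codRestrict X fun x => toEuclideanLin_mem_spaceX hs x.2
  let B' : EuclideanSpace ℂ (Fin r) →L[ℂ] X := β.codRestrict X fun u => hB.range_le ⟨u, rfl⟩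
  have hA' : bshift r ∘L L = L ∘L A' := by
    ext1 x
    exact bshift_obsOp CΦ hA x
  have hB' : bshift r ∘L toeplitz Θ ∘L embZero r = L ∘L B' := by
    ext1 u
    exact hB.bshift_toeplitz hA u
  have hst := stein_of_shift_invariant (X := X) hΘ.inner hL hker hA' hB'
  have hAE := adjoint_restrict_orthogonalProjectionOnto X (α := α) (A' := A') fun _ => rfl
  have hBE := adjoint_codRestrict_orthogonalProjectionOnto X (β := β) (B' := B') fun _ => rfl
  set Δ := deltaMap X (obsGramian CΦ A) with hΔ
  have hΔx : ∀ x, Δ x = X.subtypeL (Ring.inverse (ContinuousLinearMap.adjoint (E := X) L ∘L L)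
      (X.orthogonalProjectionOnto x)) := fun x => by
    rw [hΔ, deltaMap, compression_eq hA]
    rfl
  have hΔst : ∀ x, Δ x = α (Δ (ContinuousLinearMap.adjoint α x)) +
      β (ContinuousLinearMap.adjoint β x) := fun x => by
    rw [hΔx, hst, map_add, hAE, hBE, hΔx]
    rfl
  have hα : ContinuousLinearMap.adjoint α = Matrix.toEuclideanCLM (𝕜 := ℂ) Aᴴ :=
    (map_star (Matrix.toEuclideanCLM (𝕜 := ℂ)) A).symm
  have hβ : ∀ x, ContinuousLinearMap.adjoint β x = Matrix.toEuclideanLin BΘᴴ x := fun x => by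
    refine ext_inner_left ℂ fun u => ?_
    rw [ContinuousLinearMap.adjoint_inner_right, ← inner_toEuclideanLin_left]
    rfl
  obtain ⟨N, hN⟩ := (Matrix.toEuclideanCLM (n := Fin n) (𝕜 := ℂ)).surjective Δ
  rw [← hN]
  refine congrArg _ (contrGramian_eq_of_stein hA ?_).symm
  refine (Matrix.toEuclideanCLM (n := Fin n) (𝕜 := ℂ)).injective ?_
  rw [map_add, map_mul, map_mul, hN]
  ext1 x
  rw [hΔst, hα, hβ]
  refine congrArg₂ (· + ·) rfl ?_
  exact (toEuclideanLin_mul_apply BΘ BΘᴴ x).symm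

/-- Insert `1 = T_Θ T_Θ^* + P`, with `P` the orthogonal projection onto `ℳ_Φ`, between the factors
of `T_R = T_Φ^* T_Φ`. -/
theorem toeplitz_spectralFunction_eq
    (hinj : Function.Injective (ContinuousLinearMap.adjoint (toeplitz Φ)))
    (hs : IsStableRational Φ) (hobs : IsObservable C A hA) (hC : IsStateOutput C A hA Φ CΦ)
    (hΘ : IsInnerDeterminedBy Θ (spaceM C A hA Φ)) {R : RatMat m m} (hR : R = paraConj Φ * Φ) :
    toeplitz R =
      toeplitz (paraConj Φ * Θ) ∘L ContinuousLinearMap.adjoint (toeplitz (paraConj Φ * Θ)) +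
        obsOp C A hA ∘L deltaMap (spaceX C A hA Φ) (obsGramian CΦ A) ∘L
          ContinuousLinearMap.adjoint (obsOp C A hA) := by
  set X := spaceX C A hA Φ
  set L := obsOp CΦ A hA ∘L X.subtypeL
  have hL : Function.Injective L := injective_obsOp_comp_subtypeL hobs hC
  have hker : ∀ f, ContinuousLinearMap.adjoint (toeplitz Θ) f = 0 ↔ ∃ x : X, L x = f :=
    adjoint_toeplitz_eq_zero_iff hinj hC hΘ
  have hproj := isometry_adjoint_add_projection (X := X) hL hΘ.inner.adjoint_toeplitz_comp hker
  have hW : obsOp C A hA ∘L X.subtypeL = ContinuousLinearMap.adjoint (toeplitz Φ) ∘L L := by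
    ext1 x
    exact hC x x.2
  have hW' : ∀ f, X.orthogonalProjectionOnto (ContinuousLinearMap.adjoint (obsOp C A hA) f) =
      ContinuousLinearMap.adjoint (𝕜 := ℂ) (E := X) L (toeplitz Φ f) := fun f => by
    have h := congrArg (ContinuousLinearMap.adjoint (𝕜 := ℂ) (E := X) (F := L2plus m)) hW
    rw [ContinuousLinearMap.adjoint_comp, ContinuousLinearMap.adjoint_comp,
      Submodule.adjoint_subtypeL, ContinuousLinearMap.adjoint_adjoint] at h
    exact DFunLike.congr_fun h f
  rw [hR, toeplitz_paraConj_mul hs hs, toeplitz_paraConj_mul hs hΘ.inner.stable,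
    ContinuousLinearMap.adjoint_comp, ContinuousLinearMap.adjoint_adjoint, deltaMap,
    compression_eq hA]
  ext1 f
  have h1 := congrArg (ContinuousLinearMap.adjoint (toeplitz Φ)) (hproj (toeplitz Φ f))
  rw [map_add, ← hW'] at h1
  refine h1.symm.trans (congrArg₂ (· + ·) rfl ?_)
  exact (DFunLike.congr_fun hW _).symm

end

end

theorem proposition2p7 {m n r : ℕ}
    (A : Matrix (Fin n) (Fin n) ℂ) (C : Matrix (Fin m) (Fin n) ℂ)
    (Γ : Matrix (Fin n) (Fin m) ℂ) (R₀ : Matrix (Fin m) (Fin m) ℂ)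
    (hA : IsStableMat A)
    (hR : ∀ ζ : ℂ, ‖ζ‖ = 1 → (evalMat (spectralFunction A C Γ R₀) ζ).PosSemidef)
    (Φ : RatMat r m) (hΦ : IsOuterSpectralFactor (spectralFunction A C Γ R₀) Φ)
    (Θ : RatMat r r) (hΘ : IsInnerDeterminedBy Θ (spaceM C A hA Φ))
    (hobs : IsObservable C A hA) :
    IsStableRational (paraConj Φ * Θ) ∧
    (∃ CΦ : Matrix (Fin r) (Fin n) ℂ, IsStateOutput C A hA Φ CΦ) ∧
    ∀ CΦ : Matrix (Fin r) (Fin n) ℂ, IsStateOutput C A hA Φ CΦ →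
      (∃ (BΘ : Matrix (Fin n) (Fin r) ℂ) (DΘ : Matrix (Fin r) (Fin r) ℂ),
        IsThetaRealization (spaceX C A hA Φ) A CΦ Θ BΘ DΘ) ∧
      ∀ (BΘ : Matrix (Fin n) (Fin r) ℂ) (DΘ : Matrix (Fin r) (Fin r) ℂ),
        IsThetaRealization (spaceX C A hA Φ) A CΦ Θ BΘ DΘ →
        paraConj Φ * Θ =
          realization ((evalMat Φ 0)ᴴ * DΘ + Γᴴ * obsGramian CΦ A * BΘ) C A BΘ ∧
        IsUnit (compression (spaceX C A hA Φ) (obsGramian CΦ A)) ∧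
        deltaMap (spaceX C A hA Φ) (obsGramian CΦ A) =
          Matrix.toEuclideanCLM (𝕜 := ℂ) (contrGramian A BΘ) ∧
        toeplitz (spectralFunction A C Γ R₀) =
          toeplitz (paraConj Φ * Θ) ∘L ContinuousLinearMap.adjoint (toeplitz (paraConj Φ * Θ)) +
          obsOp C A hA ∘L deltaMap (spaceX C A hA Φ) (obsGramian CΦ A) ∘L
            ContinuousLinearMap.adjoint (obsOp C A hA) := by
  have hs := hΦ.stable
  have hinj := injective_adjoint_of_denseRange hΦ.outer
  refine ⟨?_, exists_isStateOutput hs hinj, fun CΦ hC =>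
    ⟨exists_isThetaRealization hinj hobs hC hΘ, fun BΘ DΘ hB => ⟨?_, ?_, ?_, ?_⟩⟩⟩
  · obtain ⟨CΦ, hC⟩ := exists_isStateOutput (C := C) (hA := hA) hs hinj
    obtain ⟨BΘ, DΘ, hB⟩ := exists_isThetaRealization hinj hobs hC hΘ
    rw [paraConj_mul_eq_realization hinj hs hC hΦ.factor hΘ hB]
    exact isStableRational_realization hA _ C BΘ
  · exact paraConj_mul_eq_realization hinj hs hC hΦ.factor hΘ hB
  · rw [compression_eq hA]
    exact isUnit_adjoint_comp_self (injective_obsOp_comp_subtypeL hobs hC)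
  · exact deltaMap_eq_contrGramian hinj hs hobs hC hΘ hB
  · exact toeplitz_spectralFunction_eq hinj hs hobs hC hΘ hΦ.factor
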